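/- **Setting.** On $\mathfrak H=L^2(\mathbb R,dx)$ let $(Q\psi)(x)=x\psi(x)$, $P=-i\,d/dx$ and, for $z=(q+ip)/\sqrt2\in\mathbb C$, let $D(z)=e^{i(pQ-qP)}$, i.e. $(D(z)\psi)(x)=e^{ip(x-q/2)}\psi(x-q)$. Put $q(z)=\sqrt2\,\mathrm{Re}\,z$, $p(z)=\sqrt2\,\mathrm{Im}\,z$. Operator integrals are weak, on the dense space $\mathcal S=\mathcal S(\mathbb R)\subset\mathfrak H$ of Schwartz vectors: a bounded operator $\mathsf M$ is defined by a weight $\varpi:\mathbb C\to\mathbb C$, written $\mathsf M=\int_{\mathbb C}\varpi(z)D(z)\frac{d^2z}{\pi}$, if for all $\varphi,\psi\in\mathcal S$ the function $\varpi(z)\langle\varphi,D(z)\psi\rangle$ is integrable and $\langle\varphi,\mathsf M\psi\rangle=\int\varpi(z)\langle\varphi,D(z)\psi\rangle\frac{d^2z}{\pi}$. Put $\mathsf M(z)=D(z)\mathsf M D(z)^\dagger$. For $f:\mathbb C\to\mathbb C$ let $B_f(\varphi,\psi)=\int_{\mathbb C}\langle\varphi,\mathsf M(z)\psi\rangle f(z)\frac{d^2z}{\pi}$,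 and let $A_f=\int_{\mathbb C}\mathsf M(z)f(z)\frac{d^2z}{\pi}$ be the operator of this form: its domain consists of those $\psi\in\mathcal S$ for which $B_f(\varphi,\psi)$ converges absolutely for every $\varphi\in\mathcal S$ and there is a vector $A_f\psi\in\mathfrak H$ with $B_f(\varphi,\psi)=\langle\varphi,A_f\psi\rangle$ for every $\varphi\in\mathcal S$. For $f:\mathbb R\to\mathbb C$ measurable, $f(Q)$ is multiplication by $f(x)$ and $f(P)=\mathcal F^{-1}f(2\pi\xi)\mathcal F$, on their maximal domains, where $(\mathcal F\psi)(\xi)=\int e^{-2\pi ix\xi}\psi(x)\,dx$. We write $A_{f(q)}$, $A_{f(p)}$ for the quantizations of $z\mapsto f(q(z))$, $z\mapsto f(p(z))$. **Theorem.** (a) Let $m:\mathbb R\to\mathbb R$ be measurable and continuous at $0$ with $m(0)=1$, and suppose that $\varpi(z)=m(\mathrm{Im}(z^2))$ defines a bounded operator $\mathsf M$ as above. Then $A_{f(q)}=f(Q)$ and $A_{f(p)}=f(P)$, in the following sense. 1. For every measurable $f:\mathbb R\to\mathbb C$ and $\varphi,\psi\in\mathcal S$: if the integral $B_{f(q)}(\varphi,\psi)$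 converges absolutely, then so does $\int\overline{\varphi(x)}f(x)\psi(x)\,dx$ and the two are equal; if $B_{f(p)}(\varphi,\psi)$ converges absolutely, then so does $\int\overline{\mathcal F\varphi(\xi)}f(2\pi\xi)\mathcal F\psi(\xi)\,d\xi$ and the two are equal. 2. For every measurable $f$, $A_{f(q)}\subseteq f(Q)$ and $A_{f(p)}\subseteq f(P)$; if $A_{f(q)}$ (respectively $A_{f(p)}$) is defined on all of $\mathcal S$, then its closure is equal to $f(Q)$ (respectively $f(P)$). 3. If $f(x)=\int e^{itx}d\nu(t)$ for a finite complex measure $\nu$, then, without any convergence assumption, for all $\varphi,\psi\in\mathcal S$, $$\lim_{\varepsilon\to0^+}\int_{\mathbb C}e^{-\varepsilon|z|^2}\langle\varphi,\mathsf M(z)\psi\rangle f(q(z))\frac{d^2z}{\pi}=\int\overline{\varphi(x)}f(x)\psi(x)\,dx,$$ $$\lim_{\varepsilon\to0^+}\int_{\mathbb C}e^{-\varepsilon|z|^2}\langle\varphi,\mathsf M(z)\psi\rangle f(p(z))\frac{d^2z}{\pi}=\int\overline{\mathcal F\varphi(\xi)}f(2\pi\xi)\mathcal F\psi(\xi)\,d\xi,$$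 where the integrals on the left converge absolutely for each $\varepsilon>0$. 4. If $m$ is $C^\infty$ and $m$ and all its derivatives grow at most polynomially, then for every measurable $f$ of at most polynomial growth $A_{f(q)}$ and $A_{f(p)}$ have domain $\mathcal S$, and their closures are $f(Q)$ and $f(P)$. (b) Weyl–Wigner quantization, given by $\mathsf M=2\mathsf P$ with $(\mathsf P\psi)(x)=\psi(-x)$, is the case $m\equiv1$, and it has the property in the conclusion of 4. (c) It is not the only one: there are a $C^\infty$ function $m$ with $m(0)=1$, polynomially bounded with all its derivatives, and a bounded operator $\mathsf M$ defined by the weight $m(\mathrm{Im}(z^2))$, such that the corresponding quantization has the property in the conclusion of 4 but is different from Weyl–Wigner quantization: for some $F:\mathbb C\to\mathbb C$ both quantizations of $F$ have domain $\mathcal S$, and they are different operators. -/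

import Mathlib

open MeasureTheory SchwartzMap

open scoped FourierTransform InnerProductSpace

noncomputable section

namespace WeylHeisenberg

/-- The Hilbert space `L²(ℝ, dx)` of the Schrödinger representation. -/
abbrev StateSpace : Type := Lp ℂ 2 (volume : Measure ℝ)

/-- The coordinate `q` of the phase space point `z = (q + i p) / √2`. -/
def position (z : ℂ) : ℝ := √2 * z.re

/-- The coordinate `p` of the phase space point `z = (q + i p) / √2`. -/
def momentum (z : ℂ) : ℝ := √2 * z.im

/-- `x ↦ exp (i p (x - q / 2)) φ (x - q)`, where `z = (q + i p) / √2`. -/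
def displacementFun (z : ℂ) (φ : ℝ → ℂ) (x : ℝ) : ℂ :=
  Complex.exp (((momentum z * (x - position z / 2) : ℝ) : ℂ) * Complex.I) * φ (x - position z)

theorem aestronglyMeasurable_displacementFun (z : ℂ) {φ : ℝ → ℂ}
    (hφ : AEStronglyMeasurable φ (volume : Measure ℝ)) :
    AEStronglyMeasurable (displacementFun z φ) (volume : Measure ℝ) := by
  refine AEStronglyMeasurable.mul ?_ ?_
  · exact Continuous.aestronglyMeasurable (by fun_prop)
  · exact hφ.comp_measurePreserving (measurePreserving_sub_right volume (position z))

theorem eLpNorm_displacementFun (z : ℂ) {φ : ℝ → ℂ}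
    (hφ : AEStronglyMeasurable φ (volume : Measure ℝ)) :
    eLpNorm (displacementFun z φ) 2 volume = eLpNorm φ 2 volume := by
  rw [← eLpNorm_comp_measurePreserving hφ (measurePreserving_sub_right volume (position z))]
  refine eLpNorm_congr_norm_ae (Filter.Eventually.of_forall fun x => ?_)
  simp only [displacementFun, norm_mul, Complex.norm_exp_ofReal_mul_I, one_mul, Function.comp]

theorem memLp_displacementFun (z : ℂ) {φ : ℝ → ℂ} (hφ : MemLp φ 2 (volume : Measure ℝ)) :
    MemLp (displacementFun z φ) 2 (volume : Measure ℝ) :=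
  ⟨aestronglyMeasurable_displacementFun z hφ.1, by
    rw [eLpNorm_displacementFun z hφ.1]; exact hφ.2⟩

theorem displacementFun_congr (z : ℂ) {φ ψ : ℝ → ℂ} (h : φ =ᵐ[volume] ψ) :
    displacementFun z φ =ᵐ[volume] displacementFun z ψ := by
  have := (measurePreserving_sub_right (volume : Measure ℝ)
    (position z)).quasiMeasurePreserving.ae_eq_comp h
  filter_upwards [this] with x hx
  simp only [Function.comp] at hx
  simp only [displacementFun, hx]

/-- The displacement operator `D(z) = exp (z a† - z̄ a) = exp (i (p Q - q P))` on `L²(ℝ)`. -/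
def displacement (z : ℂ) : StateSpace →ₗᵢ[ℂ] StateSpace where
  toFun φ := (memLp_displacementFun z (Lp.memLp φ)).toLp (displacementFun z φ)
  map_add' φ ψ := by
    rw [← MemLp.toLp_add]
    refine MemLp.toLp_congr _ _ ((displacementFun_congr z (Lp.coeFn_add φ ψ)).trans ?_)
    exact Filter.Eventually.of_forall fun x => by
      simp only [displacementFun, Pi.add_apply, mul_add]
  map_smul' c φ := by
    rw [RingHom.id_apply, ← MemLp.toLp_const_smul]
    refine MemLp.toLp_congr _ _ ((displacementFun_congr z (Lp.coeFn_smul c φ)).trans ?_)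
    exact Filter.Eventually.of_forall fun x => by
      simp only [displacementFun, Pi.smul_apply, smul_eq_mul, mul_left_comm]
  norm_map' φ := by
    change ‖(memLp_displacementFun z (Lp.memLp φ)).toLp (displacementFun z φ)‖ = ‖φ‖
    rw [Lp.norm_toLp, eLpNorm_displacementFun z (Lp.memLp φ).1, Lp.norm_def]

/-- A Schwartz function as a vector of `L²(ℝ)`. -/
def vec (φ : 𝓢(ℝ, ℂ)) : StateSpace := SchwartzMap.toLpCLM ℂ ℂ 2 volume φ

/-- The dense subspace of Schwartz vectors, on which the weak integrals are tested. -/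
def schwartzDomain : Submodule ℂ StateSpace :=
  LinearMap.range (SchwartzMap.toLpCLM ℂ ℂ 2 (volume : Measure ℝ)).toLinearMap

theorem dense_schwartzDomain : Dense (schwartzDomain : Set StateSpace) := by
  have h : DenseRange (SchwartzMap.toLpCLM ℝ (E := ℝ) ℂ 2 (volume : Measure ℝ)) :=
    SchwartzMap.denseRange_toLpCLM ENNReal.ofNat_ne_top
  have e : (schwartzDomain : Set StateSpace)
      = Set.range (SchwartzMap.toLpCLM ℝ (E := ℝ) ℂ 2 (volume : Measure ℝ)) := by
    ext x
    simp only [schwartzDomain, LinearMap.coe_range, Set.mem_range]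
    rfl
  rw [e]
  exact h

/-- `M = ∫ ϖ(z) D(z) d²z / π` as a bounded operator, the integral being weak, on Schwartz
vectors. -/
def IsOperatorOfWeight (ϖ : ℂ → ℂ) (M : StateSpace →L[ℂ] StateSpace) : Prop :=
  ∀ φ ψ : 𝓢(ℝ, ℂ),
    Integrable (fun z : ℂ => ϖ z * ⟪vec φ, displacement z (vec ψ)⟫_ℂ) ∧
    ⟪vec φ, M (vec ψ)⟫_ℂ =
      (Real.pi : ℂ)⁻¹ * ∫ z : ℂ, ϖ z * ⟪vec φ, displacement z (vec ψ)⟫_ℂ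

/-- The displaced operator `M(z) = D(z) M D(z)†`. -/
def displaced (M : StateSpace →L[ℂ] StateSpace) (z : ℂ) : StateSpace →L[ℂ] StateSpace :=
  (displacement z).toContinuousLinearMap ∘L M ∘L
    (displacement z).toContinuousLinearMap.adjoint

/-- The integrand `⟨φ, M(z) ψ⟩ f(z)` of the form of `A_f`. -/
def formIntegrand (M : StateSpace →L[ℂ] StateSpace) (f : ℂ → ℂ) (φ ψ : StateSpace) (z : ℂ) : ℂ :=
  f z * ⟪φ, displaced M z ψ⟫_ℂ

/-- The sesquilinear form `B_f(φ, ψ) = ∫ ⟨φ, M(z) ψ⟩ f(z) d²z / π`. -/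
def quantForm (M : StateSpace →L[ℂ] StateSpace) (f : ℂ → ℂ) (φ ψ : StateSpace) : ℂ :=
  (Real.pi : ℂ)⁻¹ * ∫ z : ℂ, formIntegrand M f φ ψ z

/-- The form `B_f(φ, ψ)`, its integral being Gaussian summable only, has the value `b`:
`∫ exp (-ε |z|²) ⟨φ, M(z) ψ⟩ f(z) d²z / π → b` as `ε → 0+`. -/
def QuantFormTendsto (M : StateSpace →L[ℂ] StateSpace) (f : ℂ → ℂ) (φ ψ : StateSpace)
    (b : ℂ) : Prop :=
  (∀ ε : ℝ, 0 < ε →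
    Integrable fun z : ℂ => (Real.exp (-ε * ‖z‖ ^ 2) : ℂ) * formIntegrand M f φ ψ z) ∧
  Filter.Tendsto
    (fun ε : ℝ => (Real.pi : ℂ)⁻¹ *
      ∫ z : ℂ, (Real.exp (-ε * ‖z‖ ^ 2) : ℂ) * formIntegrand M f φ ψ z)
    (nhdsWithin 0 (Set.Ioi 0)) (nhds b)

/-- The pairs `(ψ, η)` with `ψ` a Schwartz vector such that, for all Schwartz vectors `φ`, the
integral of `B_f(φ, ψ)` converges and `B_f(φ, ψ) = ⟨φ, η⟩`. -/
def quantGraph (M : StateSpace →L[ℂ] StateSpace) (f : ℂ → ℂ) :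
    Submodule ℂ (StateSpace × StateSpace) where
  carrier := {x | x.1 ∈ schwartzDomain ∧ ∀ φ ∈ schwartzDomain,
    Integrable (formIntegrand M f φ x.1) ∧ quantForm M f φ x.1 = ⟪φ, x.2⟫_ℂ}
  zero_mem' := by
    refine ⟨Submodule.zero_mem _, fun φ _ => ?_⟩
    have h : formIntegrand M f φ (0 : StateSpace × StateSpace).1 = fun _ => 0 := by
      funext z
      simp [formIntegrand]
    rw [quantForm, h]
    simp
  add_mem' := by
    rintro x y ⟨hx, hx'⟩ ⟨hy, hy'⟩
    refine ⟨Submodule.add_mem _ hx hy, fun φ hφ => ?_⟩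
    obtain ⟨ix, ex⟩ := hx' φ hφ
    obtain ⟨iy, ey⟩ := hy' φ hφ
    have h : formIntegrand M f φ (x + y).1
        = fun z => formIntegrand M f φ x.1 z + formIntegrand M f φ y.1 z := by
      funext z
      simp [formIntegrand, inner_add_right, mul_add]
    refine ⟨h ▸ ix.add iy, ?_⟩
    rw [quantForm, h, integral_add ix iy, mul_add, Prod.snd_add, inner_add_right, ← ex, ← ey]
    rfl
  smul_mem' := by
    rintro c x ⟨hx, hx'⟩
    refine ⟨Submodule.smul_mem _ c hx, fun φ hφ => ?_⟩
    obtain ⟨ix, ex⟩ := hx' φ hφ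
    have h : formIntegrand M f φ (c • x).1 = fun z => c * formIntegrand M f φ x.1 z := by
      funext z
      simp [formIntegrand, inner_smul_right, mul_left_comm]
    refine ⟨h ▸ ix.const_mul c, ?_⟩
    rw [quantForm, h, integral_const_mul, Prod.smul_snd, inner_smul_right, ← ex, quantForm,
      mul_left_comm]

/-- The operator `A_f = ∫ M(z) f(z) d²z / π`: the operator of the form `B_f` on Schwartz vectors.
Its domain consists of the Schwartz vectors `ψ` for which `B_f(φ, ψ)` converges for all Schwartz
vectors `φ` and is represented by a vector `A_f ψ` of the Hilbert space. -/
def quantize (M : StateSpace →L[ℂ] StateSpace) (f : ℂ → ℂ) : StateSpace →ₗ.[ℂ] StateSpace :=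
  (quantGraph M f).toLinearPMap

theorem graph_quantize (M : StateSpace →L[ℂ] StateSpace) (f : ℂ → ℂ) :
    (quantize M f).graph = quantGraph M f := by
  refine Submodule.toLinearPMap_graph_eq _ ?_
  rintro ⟨ψ, η⟩ ⟨-, h⟩ (h0 : ψ = 0)
  subst h0
  refine dense_schwartzDomain.eq_zero_of_inner_right (𝕜 := ℂ) fun φ hφ => ?_
  obtain ⟨-, e⟩ := h φ hφ
  have h1 : formIntegrand M f φ (0 : StateSpace) = fun _ => 0 := by
    funext z
    simp [formIntegrand]
  change quantForm M f φ 0 = _ at e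
  rw [quantForm, h1] at e
  simpa using e.symm

/-- The pairs `(ψ, η)` in `L²(ℝ)` with `η = g ψ` almost everywhere. -/
def multiplicationGraph (g : ℝ → ℂ) : Submodule ℂ (StateSpace × StateSpace) where
  carrier := {x | (x.2 : ℝ → ℂ) =ᵐ[volume] fun t => g t * x.1 t}
  zero_mem' := by
    filter_upwards [Lp.coeFn_zero ℂ 2 (volume : Measure ℝ)] with t
    simp
  add_mem' := by
    rintro x y hx hy
    change _ =ᵐ[volume] _ at hx hy ⊢
    filter_upwards [hx, hy, Lp.coeFn_add x.1 y.1, Lp.coeFn_add x.2 y.2] with t h1 h2 h3 h4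
    simp only [Prod.fst_add, Prod.snd_add, h3, h4, Pi.add_apply, h1, h2, mul_add]
  smul_mem' := by
    rintro c x hx
    change _ =ᵐ[volume] _ at hx ⊢
    filter_upwards [hx, Lp.coeFn_smul c x.1, Lp.coeFn_smul c x.2] with t h1 h3 h4
    simp only [Prod.smul_fst, Prod.smul_snd, h3, h4, Pi.smul_apply, h1, smul_eq_mul,
      mul_left_comm]

/-- `f(Q)`, for the position operator `(Q ψ)(x) = x ψ(x)`: multiplication by `f(x)` on its maximal
domain `{ψ ∈ L² | f ψ ∈ L²}`. -/
def functionOfQ (f : ℝ → ℂ) : StateSpace →ₗ.[ℂ] StateSpace :=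
  (multiplicationGraph f).toLinearPMap

/-- `f(P)`, for the momentum operator `P = -i d/dx`: as the transform `𝓕` with kernel
`exp (-2πi x ξ)` turns `P` into multiplication by `2πξ`, it is `𝓕⁻¹ ∘ f(2πξ) ∘ 𝓕` on its maximal
domain `{ψ ∈ L² | f(2πξ) (𝓕 ψ)(ξ) ∈ L²}`. -/
def functionOfP (f : ℝ → ℂ) : StateSpace →ₗ.[ℂ] StateSpace :=
  ((multiplicationGraph fun ξ => f (2 * Real.pi * ξ)).comap
    ((Lp.fourierTransformₗᵢ ℝ ℂ).toLinearEquiv.toLinearMap.prodMap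
      (Lp.fourierTransformₗᵢ ℝ ℂ).toLinearEquiv.toLinearMap)).toLinearPMap

theorem multiplicationGraph_functional (g : ℝ → ℂ) (x : StateSpace × StateSpace)
    (hx : x ∈ multiplicationGraph g) (h0 : x.1 = 0) : x.2 = 0 := by
  change _ =ᵐ[volume] _ at hx
  refine Lp.ext ?_
  filter_upwards [hx, Lp.coeFn_zero ℂ 2 (volume : Measure ℝ)] with t h1 h2
  rw [h1, h0, h2]
  simp

theorem mem_graph_functionOfQ (f : ℝ → ℂ) (ψ η : StateSpace) :
    (ψ, η) ∈ (functionOfQ f).graph ↔ (η : ℝ → ℂ) =ᵐ[volume] fun x => f x * ψ x := by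
  rw [functionOfQ, Submodule.toLinearPMap_graph_eq _ (multiplicationGraph_functional f)]
  rfl

theorem mem_graph_functionOfP (f : ℝ → ℂ) (ψ η : StateSpace) :
    (ψ, η) ∈ (functionOfP f).graph ↔
      ((𝓕 η : StateSpace) : ℝ → ℂ) =ᵐ[volume]
        fun ξ => f (2 * Real.pi * ξ) * (𝓕 ψ : StateSpace) ξ := by
  rw [functionOfP, Submodule.toLinearPMap_graph_eq]
  · rfl
  · intro x hx h0
    have := multiplicationGraph_functional _ _ hx
      (show Lp.fourierTransformₗᵢ ℝ ℂ x.1 = 0 by rw [h0, map_zero])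
    exact (Lp.fourierTransformₗᵢ ℝ ℂ).map_eq_zero_iff.mp this

/-- The weight `ϖ(z) = m(Im z²)`. -/
def hyperbolicWeight (m : ℝ → ℝ) (z : ℂ) : ℂ := (m (z ^ 2).im : ℂ)

/-- The parity operator `(Π ψ)(x) = ψ(-x)`. -/
def parity : StateSpace →L[ℂ] StateSpace :=
  (Lp.compMeasurePreservingₗᵢ ℂ (fun x : ℝ => -x)
    (Measure.measurePreserving_neg volume)).toContinuousLinearMap

/-- The operator `M = 2Π` of Weyl–Wigner quantization. -/
def weylWigner : StateSpace →L[ℂ] StateSpace := (2 : ℂ) • parity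

/-- Measurable functions of at most polynomial growth. -/
def IsSlowlyIncreasing (f : ℝ → ℂ) : Prop :=
  Measurable f ∧ ∃ (C : ℝ) (k : ℕ), ∀ x, ‖f x‖ ≤ C * (1 + |x|) ^ k

/-- Fourier transforms `f(x) = ∫ exp (i t x) g(t) dμ(t)` of finite complex measures `g μ`; for
instance constants, `exp (i t x)`, and Schwartz functions. -/
def IsFourierStieltjes (f : ℝ → ℂ) : Prop :=
  ∃ (μ : Measure ℝ) (g : ℝ → ℂ), IsFiniteMeasure μ ∧ Integrable g μ ∧
    ∀ x, f x = ∫ t, Complex.exp (((t * x : ℝ) : ℂ) * Complex.I) * g t ∂μ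

/-- `A_{f(q)} = f(Q)` and `A_{f(p)} = f(P)` for all slowly increasing `f`: the left-hand sides
are defined on all Schwartz vectors, and their closures are the right-hand sides. -/
def IsCanonicalOnQAndP (M : StateSpace →L[ℂ] StateSpace) : Prop :=
  ∀ f : ℝ → ℂ, IsSlowlyIncreasing f →
    ((quantize M fun z => f (position z)).domain = schwartzDomain ∧
      (quantize M fun z => f (position z)).closure = functionOfQ f) ∧
    ((quantize M fun z => f (momentum z)).domain = schwartzDomain ∧
      (quantize M fun z => f (momentum z)).closure = functionOfP f)

end WeylHeisenberg

end

/-!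
The cross-ambiguity function `A(z) = ⟨φ, D(z) ψ⟩` is a Schwartz function on phase space, and by
covariance `z ↦ ⟨φ, M(z) ψ⟩` is the symplectic Fourier transform of `ϖ A`. Smearing it with a
function of one coordinate only is therefore, by the projection–slice theorem, a one-dimensional
statement about the restriction of `ϖ A` to a coordinate axis. There `Im z² = 0`, so `ϖ = m 0 = 1`,
and the restriction of `A` is the Fourier transform of `conj φ · ψ`, or of `conj (𝓕 φ) · 𝓕 ψ`.

The difficulty is that nothing is known about `m` away from `0`, so that `ϖ A` need not be
integrable. But where `|Im z²| ≥ δ` the distance of `z` to the axis is at least `δ / (2 |z|)`, which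
bounds the heat kernels of the inversion formula by `|z|²`; and `|z|² ϖ A` is integrable, because
multiplication by `z` and its conjugate maps ambiguity functions to ambiguity functions.

The weight can be recovered from the quantization: the symplectic character of `z` is quantized to
`ϖ z • D(z)`. Hence the weights `1` and `cos (3 Im z² / 2)` give different quantizations; the
operator of the latter is a mean of two dilations, since `exp (i l Im z²)` is the weight of a
dilation composed with the parity.
-/

noncomputable section

namespace WeylHeisenberg

open Complex (I)
open Filter Module
open scoped Topology Real

section HeatKernel

variable {V : Type*} [NormedAddCommGroup V] [InnerProductSpace ℝ V]

/-- The heat kernel of total mass one on a Euclidean space, at the time `1 / (4 π² c)`, so that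
`c → ∞` is the limit of small times. It is complex-valued in order to match the Gaussians of
Mathlib's Fourier inversion. -/
def heatKernel (c : ℝ) (v : V) : ℂ :=
  (π * c : ℂ) ^ (finrank ℝ V / 2 : ℂ) * Complex.exp (-π ^ 2 * c * ‖v‖ ^ 2)

theorem continuous_heatKernel (c : ℝ) : Continuous (heatKernel c : V → ℂ) := by
  unfold heatKernel
  fun_prop

theorem norm_heatKernel {c : ℝ} (hc : 0 < c) (v : V) :
    ‖heatKernel c v‖ =
      (π * c) ^ (finrank ℝ V / 2 : ℝ) * Real.exp (-(π ^ 2 * c) * ‖v‖ ^ 2) := by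
  rw [heatKernel, norm_mul, ← Complex.ofReal_mul,
    Complex.norm_cpow_eq_rpow_re_of_pos (by positivity), Complex.norm_exp,
    show (-(π : ℂ) ^ 2 * c * ‖v‖ ^ 2) = ((-(π ^ 2 * c) * ‖v‖ ^ 2 : ℝ) : ℂ) by push_cast; ring,
    Complex.ofReal_re]
  simp

theorem norm_heatKernel_le {c : ℝ} (hc : 0 < c) (v : V) :
    ‖heatKernel c v‖ ≤ (π * c) ^ (finrank ℝ V / 2 : ℝ) := by
  rw [norm_heatKernel hc]
  refine mul_le_of_le_one_right (by positivity) (Real.exp_le_one_iff.2 ?_)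
  rw [neg_mul, neg_nonpos]
  positivity

theorem pow_mul_exp_neg_pi_mul_sq_le (n : ℕ) {t : ℝ} (ht : 0 ≤ t) :
    t ^ n * Real.exp (-(π * t ^ 2)) ≤ n.factorial * Real.exp 1 := by
  have hpow : t ^ n ≤ n.factorial * Real.exp t := by
    have := Real.pow_div_factorial_le_exp t ht n
    rwa [div_le_iff₀' (by positivity)] at this
  calc t ^ n * Real.exp (-(π * t ^ 2))
      ≤ n.factorial * Real.exp t * Real.exp (-(π * t ^ 2)) := by gcongr
    _ = n.factorial * Real.exp (t - π * t ^ 2) := by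
        rw [mul_assoc, ← Real.exp_add, sub_eq_add_neg]
    _ ≤ n.factorial * Real.exp 1 := by
        gcongr
        nlinarith [Real.pi_gt_three, sq_nonneg (t - 1), sq_nonneg t]

theorem norm_heatKernel_mul_norm_pow_le {c : ℝ} (hc : 0 < c) (v : V) :
    ‖heatKernel c v‖ * ‖v‖ ^ finrank ℝ V ≤ (finrank ℝ V).factorial * Real.exp 1 := by
  have hsqrt : √(π * c) ^ finrank ℝ V = (π * c) ^ (finrank ℝ V / 2 : ℝ) := by
    rw [Real.sqrt_eq_rpow, ← Real.rpow_mul_natCast (by positivity)]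
    ring_nf
  have hsq : π * (√(π * c) * ‖v‖) ^ 2 = π ^ 2 * c * ‖v‖ ^ 2 := by
    rw [mul_pow, Real.sq_sqrt (by positivity)]
    ring
  have := pow_mul_exp_neg_pi_mul_sq_le (finrank ℝ V) (t := √(π * c) * ‖v‖) (by positivity)
  rw [hsq, mul_pow, hsqrt] at this
  rwa [norm_heatKernel hc, neg_mul, mul_right_comm]

theorem tendsto_heatKernel_atTop {v : V} (hv : v ≠ 0) :
    Tendsto (fun c : ℝ => heatKernel c v) atTop (𝓝 0) := by
  have hexp := (tendsto_rpow_mul_exp_neg_mul_atTop_nhds_zero (finrank ℝ V / 2) (π * ‖v‖ ^ 2)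
    (by positivity)).comp (tendsto_id.const_mul_atTop Real.pi_pos)
  refine tendsto_zero_iff_norm_tendsto_zero.2 (hexp.congr' ?_)
  filter_upwards [Ioi_mem_atTop 0] with c (hc : 0 < c)
  rw [norm_heatKernel hc]
  simp only [Function.comp_apply, id]
  ring_nf

variable {E : Type*} [NormedAddCommGroup E] [NormedSpace ℂ E]

/-- The singularity `‖v - w‖ ^ (-dim)` is the rate at which the heat kernels concentrate. -/
theorem norm_heatKernel_sub_smul_le {c : ℝ} (hc : 0 < c) {v w : V} {e : E} {r : ℝ}
    (he : ‖e‖ ≤ ‖v - w‖ ^ finrank ℝ V * r) :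
    ‖heatKernel c (v - w) • e‖ ≤ (finrank ℝ V).factorial * Real.exp 1 * ‖r‖ := by
  have hr : ‖e‖ ≤ ‖v - w‖ ^ finrank ℝ V * ‖r‖ :=
    he.trans (mul_le_mul_of_nonneg_left (le_abs_self r) (by positivity))
  calc ‖heatKernel c (v - w) • e‖
      ≤ ‖heatKernel c (v - w)‖ * (‖v - w‖ ^ finrank ℝ V * ‖r‖) := by
        rw [norm_smul]
        gcongr
    _ = ‖heatKernel c (v - w)‖ * ‖v - w‖ ^ finrank ℝ V * ‖r‖ := (mul_assoc _ _ _).symm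
    _ ≤ _ := mul_le_mul_of_nonneg_right (norm_heatKernel_mul_norm_pow_le hc (v - w)) (norm_nonneg r)

variable [FiniteDimensional ℝ V] [MeasurableSpace V] [BorelSpace V]

theorem integrable_exp_neg_mul_sq_norm {b : ℝ} (hb : 0 < b) :
    Integrable fun v : V => Real.exp (-b * ‖v‖ ^ 2) := by
  have h := (GaussianFourier.integrable_cexp_neg_mul_sq_norm_add (V := V)
    (show 0 < (b : ℂ).re from hb) 0 0).norm
  refine h.congr (Eventually.of_forall fun v => ?_)
  simp only [Complex.norm_exp, zero_mul, add_zero]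
  rw [show (-(b : ℂ) * (‖v‖ : ℂ) ^ 2) = ((-b * ‖v‖ ^ 2 : ℝ) : ℂ) by push_cast; ring,
    Complex.ofReal_re]

theorem integrable_heatKernel {c : ℝ} (hc : 0 < c) : Integrable (heatKernel c : V → ℂ) := by
  refine (integrable_norm_iff (continuous_heatKernel c).aestronglyMeasurable).1 ?_
  simp_rw [norm_heatKernel hc]
  exact (integrable_exp_neg_mul_sq_norm (by positivity)).const_mul _

theorem integral_norm_heatKernel {c : ℝ} (hc : 0 < c) : ∫ v : V, ‖heatKernel c v‖ = 1 := by
  simp_rw [norm_heatKernel hc]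
  rw [integral_const_mul, GaussianFourier.integral_rexp_neg_mul_sq_norm (by positivity),
    ← Real.mul_rpow (by positivity) (by positivity),
    show π * c * (π / (π ^ 2 * c)) = 1 by field_simp, Real.one_rpow]

theorem integrable_heatKernel_sub_smul {c : ℝ} (hc : 0 < c) {G : V → E} (hG : Integrable G)
    (v : V) : Integrable fun w => heatKernel c (v - w) • G w :=
  hG.bdd_smul _ ((continuous_heatKernel c).comp (by fun_prop)).aestronglyMeasurable
    (Eventually.of_forall fun w => norm_heatKernel_le hc (v - w))

theorem continuous_integral_heatKernel_sub_smul {c : ℝ} (hc : 0 < c) {G : V → E}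
    (hG : Integrable G) : Continuous fun v : V => ∫ w, heatKernel c (v - w) • G w := by
  refine continuous_of_dominated
    (fun v => (integrable_heatKernel_sub_smul hc hG v).aestronglyMeasurable)
    (fun v => Eventually.of_forall fun w => ?_)
    (hG.norm.const_mul ((π * c) ^ (finrank ℝ V / 2 : ℝ)))
    (Eventually.of_forall fun w =>
      ((continuous_heatKernel c).comp (continuous_id.sub continuous_const)).smul continuous_const)
  rw [norm_smul]
  gcongr
  exact norm_heatKernel_le hc (v - w)

theorem norm_integral_heatKernel_sub_smul_le {c S : ℝ} (hc : 0 < c) {v : V} {G₁ G₂ : V → E}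
    {h : V → ℝ} (i₁ : Integrable G₁) (i₂ : Integrable G₂) (ih : Integrable h)
    (h₁ : ∀ w, ‖G₁ w‖ ≤ S) (h₂ : ∀ w, ‖G₂ w‖ ≤ ‖v - w‖ ^ finrank ℝ V * h w) :
    ‖∫ w, heatKernel c (v - w) • (G₁ + G₂) w‖ ≤
      S + (finrank ℝ V).factorial * Real.exp 1 * ∫ w, ‖h w‖ := by
  have ik : Integrable fun w => ‖heatKernel c (v - w)‖ :=
    (integrable_heatKernel hc).norm.comp_sub_left v
  simp only [Pi.add_apply, smul_add]
  rw [integral_add (integrable_heatKernel_sub_smul hc i₁ v)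
    (integrable_heatKernel_sub_smul hc i₂ v)]
  refine (norm_add_le _ _).trans (add_le_add ?_ ?_)
  · calc ‖∫ w, heatKernel c (v - w) • G₁ w‖ ≤ ∫ w, ‖heatKernel c (v - w)‖ * S := by
          refine norm_integral_le_of_norm_le (ik.mul_const S) (Eventually.of_forall fun w => ?_)
          rw [norm_smul]
          gcongr
          exact h₁ w
      _ = S := by
          rw [integral_mul_const, integral_sub_left_eq_self (fun w => ‖heatKernel c w‖),
            integral_norm_heatKernel hc, one_mul]
  · rw [← integral_const_mul]
    exact norm_integral_le_of_norm_le (ih.norm.const_mul _)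
      (Eventually.of_forall fun w => norm_heatKernel_sub_smul_le hc (h₂ w))

theorem tendsto_integral_heatKernel_sub_smul [CompleteSpace E] {G : V → E} (hG : Integrable G)
    {v : V} (hv : ContinuousAt G v) :
    Tendsto (fun c : ℝ => ∫ w, heatKernel c (v - w) • G w) atTop (𝓝 (G v)) :=
  Real.tendsto_integral_gaussian_smul' hG hv

theorem tendsto_integral_heatKernel_sub_smul_zero [Nontrivial V] {G : V → E} {h : V → ℝ} {v : V}
    (hG : AEStronglyMeasurable G) (ih : Integrable h)
    (hle : ∀ᵐ w, ‖G w‖ ≤ ‖v - w‖ ^ finrank ℝ V * h w) :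
    Tendsto (fun c : ℝ => ∫ w, heatKernel c (v - w) • G w) atTop (𝓝 0) := by
  rw [← integral_zero V E]
  refine tendsto_integral_filter_of_dominated_convergence
    (fun w => (finrank ℝ V).factorial * Real.exp 1 * ‖h w‖) ?_ ?_ (ih.norm.const_mul _) ?_
  · exact Eventually.of_forall fun c =>
      ((continuous_heatKernel c).comp (by fun_prop)).aestronglyMeasurable.smul hG
  · filter_upwards [Ioi_mem_atTop 0] with c (hc : 0 < c)
    filter_upwards [hle] with w hw using norm_heatKernel_sub_smul_le hc hw
  · have hne : ∀ᵐ w : V, w ≠ v := by simp [ae_iff]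
    filter_upwards [hne] with w hw
    simpa using (tendsto_heatKernel_atTop (sub_ne_zero.2 hw.symm)).smul_const (G w)

/-- `G₂` need not be continuous at `v`: being small there on average, it is annihilated by the heat
kernels. -/
theorem fourierInv_fourier_add_eq [Nontrivial V] [CompleteSpace E] {G₁ G₂ : V → E} {h : V → ℝ}
    {v : V} (i₁ : Integrable G₁) (i₂ : Integrable G₂) (hc : ContinuousAt G₁ v)
    (ih : Integrable h) (hle : ∀ᵐ w, ‖G₂ w‖ ≤ ‖v - w‖ ^ finrank ℝ V * h w)
    (hF : Integrable (𝓕 (G₁ + G₂))) : 𝓕⁻ (𝓕 (G₁ + G₂)) v = G₁ v := by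
  refine tendsto_nhds_unique (Real.tendsto_integral_gaussian_smul (i₁.add i₂) hF v) ?_
  have hsum := (tendsto_integral_heatKernel_sub_smul i₁ hc).add
    (tendsto_integral_heatKernel_sub_smul_zero i₂.1 ih hle)
  rw [add_zero] at hsum
  refine hsum.congr' ?_
  filter_upwards [Ioi_mem_atTop 0] with c (hc : 0 < c)
  rw [← integral_add (integrable_heatKernel_sub_smul hc i₁ v)
    (integrable_heatKernel_sub_smul hc i₂ v)]
  exact integral_congr_ae (Eventually.of_forall fun w => (smul_add _ _ _).symm)

theorem norm_fourier_le (W : V → E) (ξ : V) : ‖𝓕 W ξ‖ ≤ ∫ w, ‖W w‖ :=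
  VectorFourier.norm_fourierIntegral_le_integral_norm _ _ _ W ξ

theorem continuous_fourierIntegral {W : V → E} (hW : Integrable W) : Continuous (𝓕 W) :=
  VectorFourier.fourierIntegral_continuous Real.continuous_fourierChar continuous_inner hW

theorem integral_gaussian_smul_fourier [CompleteSpace E] {W : V → E} (hW : Integrable W) {c : ℝ}
    (hc : 0 < c) (v : V) :
    ∫ ξ, Complex.exp (-(c : ℂ)⁻¹ * ‖ξ‖ ^ 2 + 2 * π * I * ⟪v, ξ⟫_ℝ) • 𝓕 W ξ =
      ∫ w, heatKernel c (v - w) • W w := by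
  have hgauss : Integrable fun ξ : V =>
      Complex.exp (-(c : ℂ)⁻¹ * ‖ξ‖ ^ 2 + 2 * π * I * ⟪v, ξ⟫_ℝ) :=
    GaussianFourier.integrable_cexp_neg_mul_sq_norm_add (by simpa) _ _
  have hflip := VectorFourier.integral_fourierIntegral_smul_eq_flip (L := innerₗ V)
    Real.continuous_fourierChar continuous_inner hgauss hW
  rw [flip_innerₗ] at hflip
  refine hflip.symm.trans (integral_congr_ae (Eventually.of_forall fun w => ?_))
  refine congrArg (· • W w) ((fourier_gaussian_innerProductSpace' (by simpa) v w).trans ?_)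
  rw [heatKernel]
  congr 2
  · simp
  · simp only [neg_mul, div_inv_eq_mul, neg_inj]
    ring

theorem integral_gaussian_mul_fourierStieltjes {T : Type*} [MeasurableSpace T]
    {μ : Measure T} [SFinite μ] {g : T → ℂ} (hg : Integrable g μ) {ζ : T → V}
    (hζ : Measurable ζ) {W : V → ℂ} (hW : Integrable W) {c : ℝ} (hc : 0 < c) :
    ∫ ξ, (Real.exp (-c⁻¹ * ‖ξ‖ ^ 2) : ℂ) *
        ((∫ t, Complex.exp ((2 * π * ⟪ζ t, ξ⟫_ℝ : ℝ) * I) * g t ∂μ) * 𝓕 W ξ) =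
      ∫ t, g t * (∫ w, heatKernel c (ζ t - w) • W w) ∂μ := by
  have iξ : Integrable fun ξ : V => (Real.exp (-c⁻¹ * ‖ξ‖ ^ 2) : ℂ) * 𝓕 W ξ :=
    (integrable_exp_neg_mul_sq_norm (inv_pos.2 hc)).ofReal.mul_bdd
      (continuous_fourierIntegral hW).aestronglyMeasurable
      (Eventually.of_forall (norm_fourier_le W))
  have ip : Integrable (fun p : V × T => Complex.exp ((2 * π * ⟪ζ p.2, p.1⟫_ℝ : ℝ) * I) *
      (((Real.exp (-c⁻¹ * ‖p.1‖ ^ 2) : ℂ) * 𝓕 W p.1) * g p.2)) (volume.prod μ) := by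
    refine (iξ.mul_prod hg).bdd_mul (c := 1) ?_ (Eventually.of_forall fun p => ?_)
    · exact Measurable.aestronglyMeasurable (by fun_prop)
    · rw [Complex.norm_exp_ofReal_mul_I]
  calc _ = ∫ ξ, ∫ t, Complex.exp ((2 * π * ⟪ζ t, ξ⟫_ℝ : ℝ) * I) *
        (((Real.exp (-c⁻¹ * ‖ξ‖ ^ 2) : ℂ) * 𝓕 W ξ) * g t) ∂μ := by
        refine integral_congr_ae (Eventually.of_forall fun ξ => ?_)
        simp only
        rw [mul_left_comm, ← integral_mul_const]
        congr! 2
        ring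
    _ = ∫ t, (∫ ξ, Complex.exp ((2 * π * ⟪ζ t, ξ⟫_ℝ : ℝ) * I) *
        (((Real.exp (-c⁻¹ * ‖ξ‖ ^ 2) : ℂ) * 𝓕 W ξ) * g t)) ∂μ := integral_integral_swap ip
    _ = _ := by
        refine integral_congr_ae (Eventually.of_forall fun t => ?_)
        simp only
        rw [← integral_gaussian_smul_fourier hW hc, ← integral_const_mul]
        refine integral_congr_ae (Eventually.of_forall fun ξ => ?_)
        simp only [smul_eq_mul, Complex.exp_add, Complex.ofReal_exp]
        push_cast
        ring_nf

/-- Gaussian summation of the Fourier integral `∫ a(ξ) 𝓕 W(ξ) dξ`, where `a` is the Fourier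
transform of the image under `ζ` of the complex measure `g μ`. -/
theorem tendsto_integral_gaussian_mul_fourierStieltjes {T : Type*} [MeasurableSpace T]
    {μ : Measure T} [SFinite μ] {g : T → ℂ} (hg : Integrable g μ) {ζ : T → V}
    (hζ : Measurable ζ) {W : V → ℂ} (hW : Integrable W) (hc : ∀ t, ContinuousAt W (ζ t)) {K : ℝ}
    (hK : ∀ t c, 0 < c → ‖∫ w, heatKernel c (ζ t - w) • W w‖ ≤ K) :
    Tendsto (fun c : ℝ => ∫ ξ, (Real.exp (-c⁻¹ * ‖ξ‖ ^ 2) : ℂ) *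
      ((∫ t, Complex.exp ((2 * π * ⟪ζ t, ξ⟫_ℝ : ℝ) * I) * g t ∂μ) * 𝓕 W ξ))
      atTop (𝓝 (∫ t, g t * W (ζ t) ∂μ)) := by
  suffices hlim : Tendsto (fun c : ℝ => ∫ t, g t * (∫ w, heatKernel c (ζ t - w) • W w) ∂μ)
      atTop (𝓝 (∫ t, g t * W (ζ t) ∂μ)) by
    refine hlim.congr' ?_
    filter_upwards [Ioi_mem_atTop 0] with c hc
    exact (integral_gaussian_mul_fourierStieltjes hg hζ hW hc).symm
  refine tendsto_integral_filter_of_dominated_convergence (fun t => ‖g t‖ * K) ?_ ?_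
    (hg.norm.mul_const K) (Eventually.of_forall fun t =>
      (tendsto_integral_heatKernel_sub_smul hW (hc t)).const_mul (g t))
  · filter_upwards [Ioi_mem_atTop 0] with c (hc : 0 < c)
    exact hg.1.mul ((continuous_integral_heatKernel_sub_smul hc hW).measurable.comp
      hζ).aestronglyMeasurable
  · filter_upwards [Ioi_mem_atTop 0] with c (hc : 0 < c)
    refine Eventually.of_forall fun t => ?_
    rw [norm_mul]
    exact mul_le_mul_of_nonneg_left (hK t c hc) (norm_nonneg _)

end HeatKernel

section Slice

theorem integrable_complex_iff {E : Type*} [NormedAddCommGroup E] {F : ℂ → E} :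
    Integrable F ↔ Integrable (fun p : ℝ × ℝ => F ⟨p.1, p.2⟩) (volume.prod volume) :=
  (Complex.volume_preserving_equiv_real_prod.symm.integrable_comp_emb
    (MeasurableEquiv.measurableEmbedding _)).symm

theorem integral_complex_eq {E : Type*} [NormedAddCommGroup E] [NormedSpace ℝ E] {F : ℂ → E} :
    ∫ z, F z = ∫ p : ℝ × ℝ, F ⟨p.1, p.2⟩ ∂(volume.prod volume) :=
  (Complex.volume_preserving_equiv_real_prod.symm.integral_comp
    (MeasurableEquiv.measurableEmbedding _) F).symm

theorem measurePreserving_mul_left {u : ℂ} (hu : ‖u‖ = 1) :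
    MeasurePreserving fun z : ℂ => u * z :=
  (rotation ⟨u, mem_sphere_zero_iff_norm.2 hu⟩).measurePreserving

theorem continuous_complex_mk : Continuous fun p : ℝ × ℝ => (⟨p.1, p.2⟩ : ℂ) :=
  Complex.equivRealProdCLM.symm.continuous

variable {E : Type*} [NormedAddCommGroup E] [NormedSpace ℂ E] {W W₁ W₂ : ℂ → E}

/-- The Fourier transform of a function on `ℂ` in its real variable, of frequency `r`, as a
function of its imaginary variable. -/
def reFourier (W : ℂ → E) (r b : ℝ) : E :=
  𝓕 (fun a : ℝ => W ⟨a, b⟩) r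

theorem norm_reFourier_le (W : ℂ → E) (r b : ℝ) : ‖reFourier W r b‖ ≤ ∫ a : ℝ, ‖W ⟨a, b⟩‖ :=
  norm_fourier_le _ r

theorem integrable_reFourier (hW : Integrable W) (r : ℝ) : Integrable (reFourier W r) := by
  have hphase : Integrable (fun p : ℝ × ℝ =>
      Complex.exp (↑(-2 * π * ⟪p.1, r⟫_ℝ) * I) • W ⟨p.1, p.2⟩) (volume.prod volume) := by
    refine (integrable_complex_iff.1 hW).bdd_smul 1
      (Continuous.aestronglyMeasurable (by fun_prop)) (Eventually.of_forall fun p => ?_)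
    rw [Complex.norm_exp_ofReal_mul_I]
  simpa only [show reFourier W r = fun b => 𝓕 (fun a : ℝ => W ⟨a, b⟩) r from rfl,
    Real.fourier_eq'] using hphase.integral_prod_right

theorem fourier_reFourier (hW : Integrable W) (r s : ℝ) :
    𝓕 (reFourier W r) s = 𝓕 W ⟨r, s⟩ := by
  rw [Real.fourier_eq', Real.fourier_eq', integral_complex_eq, integral_prod_symm]
  · refine integral_congr_ae (Eventually.of_forall fun b => ?_)
    simp only [reFourier, Real.fourier_eq', ← integral_smul, smul_smul, ← Complex.exp_add,
      ← add_mul, ← Complex.ofReal_add]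
    congr! 6
    simp only [neg_mul, RCLike.inner_apply, Real.ringHom_apply, Complex.inner, Complex.mul_re,
      Complex.conj_re, Complex.conj_im, mul_neg, sub_neg_eq_add]
    ring
  · refine (integrable_complex_iff.1 hW).bdd_smul 1 ?_ (Eventually.of_forall fun p => ?_)
    · have := continuous_complex_mk
      exact Continuous.aestronglyMeasurable (by fun_prop)
    · rw [Complex.norm_exp_ofReal_mul_I]

theorem reFourier_add_ae (i₁ : Integrable W₁) (i₂ : Integrable W₂) (r : ℝ) :
    reFourier (W₁ + W₂) r =ᵐ[volume] reFourier W₁ r + reFourier W₂ r := by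
  filter_upwards [(integrable_complex_iff.1 i₁).prod_left_ae,
    (integrable_complex_iff.1 i₂).prod_left_ae] with b h₁ h₂
  simp only [Pi.add_apply, reFourier, Real.fourier_eq, smul_add]
  exact integral_add ((Real.fourierIntegral_convergent_iff r).2 h₁)
    ((Real.fourierIntegral_convergent_iff r).2 h₂)

theorem continuousAt_reFourier {B : ℝ → ℝ} {b₀ : ℝ} (iB : Integrable B)
    (hB : ∀ a b, ‖W ⟨a, b⟩‖ ≤ B a)
    (hm : ∀ b, AEStronglyMeasurable fun a : ℝ => W ⟨a, b⟩)
    (hc : ∀ a, ContinuousAt (fun b => W ⟨a, b⟩) b₀) (r : ℝ) : ContinuousAt (reFourier W r) b₀ := by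
  simp only [funext fun b => Real.fourier_eq' (fun a : ℝ => W ⟨a, b⟩) r,
    show reFourier W r = fun b => 𝓕 (fun a : ℝ => W ⟨a, b⟩) r from rfl]
  refine continuousAt_of_dominated (Eventually.of_forall fun b => ?_)
    (Eventually.of_forall fun b => Eventually.of_forall fun a => ?_) iB
    (Eventually.of_forall fun a => (hc a).const_smul _)
  · exact (Continuous.aestronglyMeasurable (by fun_prop)).smul (hm b)
  · rw [norm_smul, Complex.norm_exp_ofReal_mul_I, one_mul]
    exact hB a b

variable [CompleteSpace E] {H : ℂ → ℝ} {B : ℝ → ℝ}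

/-- The projection–slice theorem for a function that is continuous at the real axis up to a
summand which is small there on average only. -/
theorem integral_fourier_mk_eq (i₁ : Integrable W₁) (i₂ : Integrable W₂) (iH : Integrable H)
    (iB : Integrable B) (hB : ∀ a b, ‖W₁ ⟨a, b⟩‖ ≤ B a)
    (hm : ∀ b, AEStronglyMeasurable fun a : ℝ => W₁ ⟨a, b⟩)
    (hc : ∀ a, ContinuousAt (fun b : ℝ => W₁ ⟨a, b⟩) 0) (hH : ∀ z, ‖W₂ z‖ ≤ |z.im| * H z)
    {r : ℝ} (hr : Integrable fun s : ℝ => 𝓕 (W₁ + W₂) ⟨r, s⟩) :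
    ∫ s : ℝ, 𝓕 (W₁ + W₂) ⟨r, s⟩ = 𝓕 (fun a : ℝ => W₁ a) r := by
  have hslice : (fun s : ℝ => 𝓕 (W₁ + W₂) ⟨r, s⟩) = 𝓕 (reFourier W₁ r + reFourier W₂ r) := by
    funext s
    rw [← fourier_reFourier (i₁.add i₂), Real.fourier_congr_ae (reFourier_add_ae i₁ i₂ r)]
  have hle : ∀ᵐ b : ℝ, ‖reFourier W₂ r b‖ ≤ ‖(0 : ℝ) - b‖ ^ finrank ℝ ℝ * ∫ a : ℝ, H ⟨a, b⟩ := by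
    filter_upwards [(integrable_complex_iff.1 i₂).prod_left_ae,
      (integrable_complex_iff.1 iH).prod_left_ae] with b h₂ h
    rw [finrank_self, pow_one, zero_sub, norm_neg, Real.norm_eq_abs, ← integral_const_mul]
    exact (norm_reFourier_le W₂ r b).trans
      (integral_mono h₂.norm (h.const_mul _) fun a => hH ⟨a, b⟩)
  rw [hslice] at hr ⊢
  have hinv := fourierInv_fourier_add_eq (integrable_reFourier i₁ r) (integrable_reFourier i₂ r)
    (continuousAt_reFourier iB hB hm hc r) (integrable_complex_iff.1 iH).integral_prod_right hle hr
  rw [Real.fourierInv_eq'] at hinv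
  simpa only [inner_zero_right, mul_zero, Complex.ofReal_zero, zero_mul, Complex.exp_zero,
    one_smul] using! hinv

theorem integral_comp_re_smul_fourier (i₁ : Integrable W₁) (i₂ : Integrable W₂)
    (iH : Integrable H) (iB : Integrable B) (hB : ∀ a b, ‖W₁ ⟨a, b⟩‖ ≤ B a)
    (hm : ∀ b, AEStronglyMeasurable fun a : ℝ => W₁ ⟨a, b⟩)
    (hc : ∀ a, ContinuousAt (fun b : ℝ => W₁ ⟨a, b⟩) 0) (hH : ∀ z, ‖W₂ z‖ ≤ |z.im| * H z)
    {f : ℝ → ℂ} (hf : Integrable fun ξ : ℂ => f ξ.re • 𝓕 (W₁ + W₂) ξ) :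
    Integrable (fun r => f r • 𝓕 (fun a : ℝ => W₁ a) r) ∧
      ∫ ξ : ℂ, f ξ.re • 𝓕 (W₁ + W₂) ξ = ∫ r, f r • 𝓕 (fun a : ℝ => W₁ a) r := by
  have hprod := integrable_complex_iff.1 hf
  have hinner : ∀ᵐ r : ℝ,
      ∫ s : ℝ, f r • 𝓕 (W₁ + W₂) ⟨r, s⟩ = f r • 𝓕 (fun a : ℝ => W₁ a) r := by
    filter_upwards [hprod.prod_right_ae] with r hr
    rcases eq_or_ne (f r) 0 with h0 | h0
    · simp [h0]
    · rw [integral_smul, integral_fourier_mk_eq i₁ i₂ iH iB hB hm hc hH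
        ((integrable_smul_iff h0 _).1 hr)]
  refine ⟨hprod.integral_prod_left.congr hinner, ?_⟩
  rw [integral_complex_eq, integral_prod _ hprod]
  exact integral_congr_ae hinner

end Slice

section HyperbolicWeight

theorem hyperbolicWeight_mul_left {u : ℂ} (hu : (u ^ 2).im = 0) (m : ℝ → ℝ) (z : ℂ) :
    hyperbolicWeight m (u * z) = hyperbolicWeight (fun s => m ((u ^ 2).re * s)) z := by
  rw [hyperbolicWeight, hyperbolicWeight, mul_pow, Complex.mul_im, hu, zero_mul, add_zero]

theorem hyperbolicWeight_of_im_sq_eq_zero {m : ℝ → ℝ} (h0 : m 0 = 1) {z : ℂ}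
    (hz : (z ^ 2).im = 0) : hyperbolicWeight m z = 1 := by
  rw [hyperbolicWeight, hz, h0, Complex.ofReal_one]

theorem measurable_hyperbolicWeight {m : ℝ → ℝ} (hm : Measurable m) :
    Measurable (hyperbolicWeight m) :=
  Complex.measurable_ofReal.comp (hm.comp (Complex.measurable_im.comp (measurable_id.pow_const 2)))

theorem continuousAt_hyperbolicWeight {m : ℝ → ℝ} (hc : ContinuousAt m 0) {v : ℂ}
    (hv : (v ^ 2).im = 0) : ContinuousAt (hyperbolicWeight m) v := by
  have hc' : ContinuousAt m (v ^ 2).im := hv ▸ hc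
  have him : Continuous fun z : ℂ => (z ^ 2).im := by fun_prop
  exact Complex.continuous_ofReal.continuousAt.comp
    (ContinuousAt.comp (f := fun z : ℂ => (z ^ 2).im) hc' him.continuousAt)

theorem abs_im_sq_le {v : ℂ} (hv : (v ^ 2).im = 0) (w : ℂ) :
    |(w ^ 2).im| ≤ 2 * (‖v - w‖ * ‖w‖) := by
  have him_sq : ∀ z : ℂ, (z ^ 2).im = 2 * (z.re * z.im) := fun z => by
    rw [sq, Complex.mul_im]
    ring
  have hre := Complex.abs_re_le_norm (v - w)
  have him := Complex.abs_im_le_norm (v - w)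
  rw [him_sq, abs_mul, abs_mul, abs_two]
  rcases (by simpa [him_sq] using hv : v.re = 0 ∨ v.im = 0) with h | h
  · rw [Complex.sub_re, h, zero_sub, abs_neg] at hre
    gcongr
    exact Complex.abs_im_le_norm w
  · rw [Complex.sub_im, h, zero_sub, abs_neg] at him
    rw [mul_comm |w.re|]
    gcongr
    exact Complex.abs_re_le_norm w

/-- The neighbourhood `|Im z²| < δ` of the two coordinate axes, bounded by hyperbolas. -/
def hyperbolicCross (δ : ℝ) : Set ℂ := {z | |(z ^ 2).im| < δ}

theorem isOpen_hyperbolicCross (δ : ℝ) : IsOpen (hyperbolicCross δ) :=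
  isOpen_lt (by fun_prop) continuous_const

theorem mem_hyperbolicCross {δ : ℝ} (hδ : 0 < δ) {v : ℂ} (hv : (v ^ 2).im = 0) :
    v ∈ hyperbolicCross δ := by
  rwa [hyperbolicCross, Set.mem_ofPred_eq, hv, abs_zero]

variable {m : ℝ → ℝ} {V : ℂ → ℂ} {δ : ℝ}

/-- Outside the hyperbolic cross the distance of `w` to the axes is at least `δ / (2 ‖w‖)`. This
compensates for the lack of control of `m` away from `0`. -/
theorem norm_indicator_compl_hyperbolicCross_le (hδ : 0 < δ) (W : ℂ → ℂ) (n : ℕ) {v : ℂ}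
    (hv : (v ^ 2).im = 0) (w : ℂ) :
    ‖(hyperbolicCross δ)ᶜ.indicator W w‖ ≤ ‖v - w‖ ^ n * ((2 / δ) ^ n * (‖w‖ ^ n * ‖W w‖)) := by
  by_cases hw : w ∈ hyperbolicCross δ
  · rw [Set.indicator_of_notMem (Set.notMem_compl_iff.2 hw), norm_zero]
    positivity
  · rw [Set.indicator_of_mem hw]
    have hone : 1 ≤ ‖v - w‖ * (2 / δ * ‖w‖) := by
      rw [show ‖v - w‖ * (2 / δ * ‖w‖) = 2 * (‖v - w‖ * ‖w‖) / δ by ring, le_div_iff₀ hδ, one_mul]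
      exact (not_lt.1 hw).trans (abs_im_sq_le hv w)
    calc ‖W w‖ ≤ (‖v - w‖ * (2 / δ * ‖w‖)) ^ n * ‖W w‖ :=
          le_mul_of_one_le_left (norm_nonneg _) (one_le_pow₀ hone)
      _ = _ := by ring

theorem norm_indicator_hyperbolicCross_le (hδ : ∀ s, |s| < δ → |m s| ≤ 2) (w : ℂ) :
    ‖(hyperbolicCross δ).indicator (fun z => hyperbolicWeight m z * V z) w‖ ≤ 2 * ‖V w‖ := by
  by_cases hw : w ∈ hyperbolicCross δ
  · rw [Set.indicator_of_mem hw, norm_mul, hyperbolicWeight, Complex.norm_real]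
    exact mul_le_mul_of_nonneg_right (hδ _ hw) (norm_nonneg _)
  · rw [Set.indicator_of_notMem hw, norm_zero]
    positivity

theorem exists_abs_le_two (hc : ContinuousAt m 0) (h0 : m 0 = 1) :
    ∃ δ > 0, ∀ s, |s| < δ → |m s| ≤ 2 := by
  obtain ⟨δ, hδ, h⟩ := Metric.continuousAt_iff.1 hc 1 one_pos
  refine ⟨δ, hδ, fun s hs => ?_⟩
  have hs' := h (show dist s 0 < δ by rwa [Real.dist_eq, sub_zero])
  rw [Real.dist_eq, h0, abs_lt] at hs'
  exact abs_le.2 ⟨by linarith, by linarith⟩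

/-- Since `m` is unbounded in general, the convolutions of `ϖ V` with heat kernels are under
control on the axes only. -/
theorem exists_norm_integral_heatKernel_hyperbolicWeight_le
    (hc : ContinuousAt m 0) (h0 : m 0 = 1) {C : ℝ} (hV : ∀ z, ‖V z‖ ≤ C)
    (hW : Integrable fun z => hyperbolicWeight m z * V z)
    (hW₂ : Integrable fun z => ‖z‖ ^ 2 * ‖hyperbolicWeight m z * V z‖) :
    ∃ K, ∀ v : ℂ, (v ^ 2).im = 0 → ∀ c : ℝ, 0 < c →
      ‖∫ w, heatKernel c (v - w) • (hyperbolicWeight m w * V w)‖ ≤ K := by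
  obtain ⟨δ, hδ, hmδ⟩ := exists_abs_le_two hc h0
  set W := fun z => hyperbolicWeight m z * V z
  have hS := (isOpen_hyperbolicCross δ).measurableSet
  refine ⟨2 * C + (finrank ℝ ℂ).factorial * Real.exp 1 *
    ∫ w, ‖(2 / δ) ^ 2 * (‖w‖ ^ 2 * ‖W w‖)‖, fun v hv c hc => ?_⟩
  have hsplit : ∀ w, W w
      = ((hyperbolicCross δ).indicator W + (hyperbolicCross δ)ᶜ.indicator W) w := fun w => by
    rw [Set.indicator_self_add_compl]
  rw [integral_congr_ae (.of_forall fun w => congrArg (heatKernel c (v - w) • ·) (hsplit w))]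
  refine norm_integral_heatKernel_sub_smul_le hc (hW.indicator hS) (hW.indicator hS.compl)
    (hW₂.const_mul ((2 / δ) ^ 2)) (fun w => ?_) ?_
  · exact (norm_indicator_hyperbolicCross_le hmδ w).trans
      (mul_le_mul_of_nonneg_left (hV w) zero_le_two)
  · rw [Complex.finrank_real_complex]
    exact norm_indicator_compl_hyperbolicCross_le hδ W 2 hv

theorem continuousAt_indicator_hyperbolicCross (hδ : 0 < δ) {W : ℂ → ℂ} {v : ℂ}
    (hv : (v ^ 2).im = 0) (hW : ContinuousAt W v) :
    ContinuousAt ((hyperbolicCross δ).indicator W) v := by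
  refine hW.congr ?_
  filter_upwards [(isOpen_hyperbolicCross δ).mem_nhds (mem_hyperbolicCross hδ hv)] with z hz
  rw [Set.indicator_of_mem hz]

theorem exists_norm_le_inv_one_add_re_sq (V : 𝓢(ℂ, ℂ)) :
    ∃ C, ∀ z : ℂ, ‖V z‖ ≤ C * (1 + z.re ^ 2)⁻¹ := by
  refine ⟨SchwartzMap.seminorm ℂ 0 0 V + SchwartzMap.seminorm ℂ 2 0 V, fun z => ?_⟩
  have h₀ := norm_le_seminorm ℂ V z
  have h₂ := norm_pow_mul_le_seminorm ℂ V 2 z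
  have hre : z.re ^ 2 * ‖V z‖ ≤ ‖z‖ ^ 2 * ‖V z‖ := by
    rw [← sq_abs z.re]
    gcongr
    exact Complex.abs_re_le_norm z
  rw [← div_eq_mul_inv, le_div_iff₀ (by positivity)]
  linarith

theorem integral_comp_re_mul_fourier_hyperbolicWeight (hm : Measurable m)
    (hc : ContinuousAt m 0) (h0 : m 0 = 1) (V : 𝓢(ℂ, ℂ))
    (hW : Integrable fun z => hyperbolicWeight m z * V z)
    (hW₁ : Integrable fun z => ‖z‖ * ‖hyperbolicWeight m z * V z‖) {f : ℝ → ℂ}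
    (hf : Integrable fun ξ : ℂ => f ξ.re * 𝓕 (fun z => hyperbolicWeight m z * V z) ξ) :
    Integrable (fun s => f s * 𝓕 (fun t : ℝ => V t) s) ∧
      ∫ ξ : ℂ, f ξ.re * 𝓕 (fun z => hyperbolicWeight m z * V z) ξ
        = ∫ s, f s * 𝓕 (fun t : ℝ => V t) s := by
  obtain ⟨δ, hδ, hmδ⟩ := exists_abs_le_two hc h0
  obtain ⟨C, hC⟩ := exists_norm_le_inv_one_add_re_sq V
  set W := fun z => hyperbolicWeight m z * V z
  set S := hyperbolicCross δ
  have hS : MeasurableSet S := (isOpen_hyperbolicCross δ).measurableSet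
  have haxis : ∀ a : ℝ, ((a : ℂ) ^ 2).im = 0 := fun a => by
    rw [← Complex.ofReal_pow, Complex.ofReal_im]
  have hslice : (fun t : ℝ => V t) = fun t : ℝ => S.indicator W t := by
    funext t
    rw [Set.indicator_of_mem (mem_hyperbolicCross hδ (haxis t))]
    simp only [W, hyperbolicWeight_of_im_sq_eq_zero h0 (haxis t), one_mul]
  have hmeas : Measurable (S.indicator W) :=
    ((measurable_hyperbolicWeight hm).mul V.continuous.measurable).indicator hS
  rw [← Set.indicator_self_add_compl S W] at hf ⊢
  rw [hslice]
  refine integral_comp_re_smul_fourier (B := fun a => 2 * (C * (1 + a ^ 2)⁻¹))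
    (H := fun z => 2 / δ * (‖z‖ * ‖W z‖)) (hW.indicator hS) (hW.indicator hS.compl)
    (hW₁.const_mul _) ((integrable_inv_one_add_sq.const_mul C).const_mul 2) (fun a b => ?_)
    (fun b => ?_) (fun a => ?_) (fun z => ?_) hf
  · exact (norm_indicator_hyperbolicCross_le hmδ _).trans
      (mul_le_mul_of_nonneg_left (hC _) zero_le_two)
  · exact (hmeas.comp (continuous_complex_mk.comp
      (Continuous.prodMk_left b)).measurable).aestronglyMeasurable
  · exact ContinuousAt.comp (f := fun b : ℝ => (⟨a, b⟩ : ℂ))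
      (continuousAt_indicator_hyperbolicCross hδ (haxis a)
        ((continuousAt_hyperbolicWeight hc (haxis a)).mul V.continuous.continuousAt))
      (continuous_complex_mk.comp (Continuous.prodMk_right a)).continuousAt
  · have h := norm_indicator_compl_hyperbolicCross_le hδ W 1 (haxis z.re) z
    have hdist : (z.re : ℂ) - z = -(z.im * I) := by linear_combination Complex.re_add_im z
    rwa [pow_one, pow_one, pow_one, hdist, norm_neg, norm_mul, Complex.norm_I, mul_one,
      Complex.norm_real, Real.norm_eq_abs] at h

/-- The projection–slice theorem for `ϖ V` and an axis on which `ϖ = 1`, a coordinate axis being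
rotated to the real axis. -/
theorem integral_comp_inner_mul_fourier_hyperbolicWeight (hm : Measurable m)
    (hc : ContinuousAt m 0) (h0 : m 0 = 1) {u : ℂ} (hu : ‖u‖ = 1) (hu₂ : (u ^ 2).im = 0)
    (V : 𝓢(ℂ, ℂ)) (hW : Integrable fun z => hyperbolicWeight m z * V z)
    (hW₁ : Integrable fun z => ‖z‖ * ‖hyperbolicWeight m z * V z‖) {f : ℝ → ℂ}
    (hf : Integrable fun ξ : ℂ => f ⟪u, ξ⟫_ℝ * 𝓕 (fun z => hyperbolicWeight m z * V z) ξ) :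
    Integrable (fun s => f s * 𝓕 (fun t : ℝ => V (t * u)) s) ∧
      ∫ ξ : ℂ, f ⟪u, ξ⟫_ℝ * 𝓕 (fun z => hyperbolicWeight m z * V z) ξ
        = ∫ s, f s * 𝓕 (fun t : ℝ => V (t * u)) s := by
  have hu₀ : u ≠ 0 := norm_ne_zero_iff.1 (hu ▸ one_ne_zero)
  have hrot := measurePreserving_mul_left hu
  have hemb := measurableEmbedding_mulLeft₀ hu₀
  set e : ℂ ≃ₗᵢ[ℝ] ℂ := rotation ⟨u, mem_sphere_zero_iff_norm.2 hu⟩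
  have he : ∀ z, e z = u * z := fun z => rfl
  set U : 𝓢(ℂ, ℂ) := compCLMOfContinuousLinearEquiv ℂ e.toContinuousLinearEquiv V
  have hU : ∀ z, U z = V (u * z) := fun z => rfl
  set n : ℝ → ℝ := fun s => m ((u ^ 2).re * s)
  have hn : (fun z => hyperbolicWeight n z * U z)
      = fun z => hyperbolicWeight m (u * z) * V (u * z) := by
    funext z
    rw [hyperbolicWeight_mul_left hu₂, hU]
  have hfourier : ∀ ξ, 𝓕 (fun z => hyperbolicWeight n z * U z) ξ
      = 𝓕 (fun z => hyperbolicWeight m z * V z) (u * ξ) := fun ξ => by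
    rw [hn]
    exact Real.fourier_comp_linearIsometry e (fun z => hyperbolicWeight m z * V z) ξ
  have hinner : ∀ ξ : ℂ, ⟪u, u * ξ⟫_ℝ = ξ.re := fun ξ => by
    have h := e.inner_map_map 1 ξ
    rw [he, he, mul_one] at h
    simpa [Complex.inner] using h
  rw [← hrot.integrable_comp_emb hemb] at hW hW₁ hf
  rw [← hrot.integral_comp hemb]
  simp only [Function.comp_def, norm_mul u, hu, one_mul, hinner, ← hfourier] at hf hW₁ ⊢
  have h := integral_comp_re_mul_fourier_hyperbolicWeight (m := n) (V := U) (by fun_prop)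
    (ContinuousAt.comp (f := fun s => (u ^ 2).re * s) (by rwa [mul_zero]) (by fun_prop))
    (by simp only [n, mul_zero, h0]) (by rw [hn]; exact hW)
    (by simpa only [n, hyperbolicWeight_mul_left hu₂, hU] using hW₁) hf
  simpa only [hU, mul_comm u] using h

end HyperbolicWeight

section Displacement

/-- The symplectic character `exp (z w̄ - z̄ w)` of phase space. -/
def symplecticCharacter (z w : ℂ) : ℂ :=
  Complex.exp (((2 * (star w * z).im : ℝ) : ℂ) * I)

theorem hasTemperateGrowth_cexp_ofReal_mul_I :
    (fun t : ℝ => Complex.exp ((t : ℂ) * I)).HasTemperateGrowth := by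
  have hderiv : ∀ n : ℕ, iteratedDeriv n (fun t : ℝ => Complex.exp ((t : ℂ) * I))
      = fun t : ℝ => I ^ n * Complex.exp ((t : ℂ) * I) := by
    intro n
    induction n with
    | zero => simp
    | succ n ih =>
      rw [iteratedDeriv_succ, ih]
      funext t
      have h : HasDerivAt (fun t : ℝ => I ^ n * Complex.exp ((t : ℂ) * I))
          (I ^ n * (Complex.exp ((t : ℂ) * I) * (1 * I))) t :=
        ((Complex.ofRealCLM.hasDerivAt.mul_const I).cexp).const_mul _
      rw [h.deriv]
      ring
  refine ⟨(Complex.ofRealCLM.contDiff.mul contDiff_const).cexp, fun n => ⟨0, 1, fun x => ?_⟩⟩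
  rw [norm_iteratedFDeriv_eq_norm_iteratedDeriv, hderiv]
  simp [Complex.norm_exp_ofReal_mul_I]

theorem hasTemperateGrowth_cexp_comp {E : Type*} [NormedAddCommGroup E] [NormedSpace ℝ E]
    {θ : E → ℝ} (hθ : θ.HasTemperateGrowth) :
    (fun x => Complex.exp ((θ x : ℂ) * I)).HasTemperateGrowth :=
  hasTemperateGrowth_cexp_ofReal_mul_I.comp hθ

/-- The displacement operator on Schwartz functions. -/
def schwartzDisplacement (z : ℂ) (φ : 𝓢(ℝ, ℂ)) : 𝓢(ℝ, ℂ) :=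
  smulLeftCLM ℂ (fun x : ℝ => Complex.exp (((momentum z * (x - position z / 2) : ℝ) : ℂ) * I))
    (compSubConstCLM ℂ (position z) φ)

theorem schwartzDisplacement_apply (z : ℂ) (φ : 𝓢(ℝ, ℂ)) (x : ℝ) :
    schwartzDisplacement z φ x = displacementFun z φ x := by
  rw [schwartzDisplacement, smulLeftCLM_apply_apply (hasTemperateGrowth_cexp_comp (by fun_prop))]
  rfl

theorem coeFn_vec (φ : 𝓢(ℝ, ℂ)) : (vec φ : ℝ → ℂ) =ᵐ[volume] φ :=
  SchwartzMap.coeFn_toLp φ 2 volume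

theorem vec_mem_schwartzDomain (φ : 𝓢(ℝ, ℂ)) : vec φ ∈ schwartzDomain := ⟨φ, rfl⟩

theorem coeFn_displacement (z : ℂ) (ψ : StateSpace) :
    (displacement z ψ : ℝ → ℂ) =ᵐ[volume] displacementFun z ψ :=
  MemLp.coeFn_toLp (memLp_displacementFun z (Lp.memLp ψ))

theorem coeFn_displacement_displacement (z w : ℂ) (ψ : StateSpace) :
    (displacement z (displacement w ψ) : ℝ → ℂ)
      =ᵐ[volume] displacementFun z (displacementFun w ψ) :=
  (coeFn_displacement z _).trans (displacementFun_congr z (coeFn_displacement w ψ))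

theorem displacement_vec (z : ℂ) (ψ : 𝓢(ℝ, ℂ)) :
    displacement z (vec ψ) = vec (schwartzDisplacement z ψ) := by
  refine Lp.ext ?_
  filter_upwards [coeFn_displacement z (vec ψ), displacementFun_congr z (coeFn_vec ψ),
    coeFn_vec (schwartzDisplacement z ψ)] with x h₁ h₂ h₃
  rw [h₁, h₂, h₃, schwartzDisplacement_apply]

theorem inner_vec_left (φ : 𝓢(ℝ, ℂ)) (η : StateSpace) :
    ⟪vec φ, η⟫_ℂ = ∫ x, star (φ x) * η x := by
  rw [L2.inner_def]
  refine integral_congr_ae ?_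
  filter_upwards [coeFn_vec φ] with x hx
  rw [hx, RCLike.inner_apply', Complex.star_def]

theorem inner_vec_eq_integral (φ : 𝓢(ℝ, ℂ)) {η : StateSpace} {h : ℝ → ℂ}
    (hη : (η : ℝ → ℂ) =ᵐ[volume] h) : ⟪vec φ, η⟫_ℂ = ∫ x, star (φ x) * h x := by
  rw [inner_vec_left]
  refine integral_congr_ae ?_
  filter_upwards [hη] with x hx
  rw [hx]

theorem displacementFun_neg_displacementFun (z : ℂ) (φ : ℝ → ℂ) :
    displacementFun z (displacementFun (-z) φ) = φ := by
  funext x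
  simp only [displacementFun, position, momentum, Complex.neg_re, Complex.neg_im]
  rw [← mul_assoc, ← Complex.exp_add, ← add_mul, ← Complex.ofReal_add,
    show √2 * z.im * (x - √2 * z.re / 2)
      + √2 * -z.im * (x - √2 * z.re - √2 * -z.re / 2) = 0 by ring,
    show x - √2 * z.re - √2 * -z.re = x by ring]
  simp

theorem displacement_neg_displacement (z : ℂ) (ψ : StateSpace) :
    displacement z (displacement (-z) ψ) = ψ := by
  refine Lp.ext ?_
  rw [← displacementFun_neg_displacementFun z ψ]
  exact coeFn_displacement_displacement z (-z) ψ

theorem adjoint_displacement (z : ℂ) (ψ : StateSpace) :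
    (displacement z).toContinuousLinearMap.adjoint ψ = displacement (-z) ψ := by
  refine ext_inner_left ℂ fun φ => ?_
  rw [ContinuousLinearMap.adjoint_inner_right]
  conv_lhs => rw [← displacement_neg_displacement z ψ]
  exact (displacement z).inner_map_map _ _

theorem inner_displaced (M : StateSpace →L[ℂ] StateSpace) (z : ℂ) (φ ψ : StateSpace) :
    ⟪φ, displaced M z ψ⟫_ℂ = ⟪displacement (-z) φ, M (displacement (-z) ψ)⟫_ℂ := by
  rw [← adjoint_displacement, ← adjoint_displacement, ContinuousLinearMap.adjoint_inner_left]
  rfl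

theorem displacementFun_displacementFun (z w : ℂ) (φ : ℝ → ℂ) (x : ℝ) :
    displacementFun z (displacementFun w φ) x
      = symplecticCharacter z w * displacementFun w (displacementFun z φ) x := by
  simp only [displacementFun, symplecticCharacter]
  rw [sub_right_comm x (position w) (position z), ← mul_assoc, ← mul_assoc, ← mul_assoc,
    ← Complex.exp_add, ← Complex.exp_add, ← Complex.exp_add]
  congr 2
  simp only [← add_mul, ← Complex.ofReal_add]
  congr 2
  simp only [position, momentum, Complex.mul_im, Complex.star_def, Complex.conj_re,
    Complex.conj_im]
  linear_combination
    (w.re * z.im - w.im * z.re) * Real.mul_self_sqrt (show (0 : ℝ) ≤ 2 by norm_num)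

theorem displacement_displacement (z w : ℂ) (ψ : StateSpace) :
    displacement z (displacement w ψ)
      = symplecticCharacter z w • displacement w (displacement z ψ) := by
  refine Lp.ext ?_
  filter_upwards [coeFn_displacement_displacement z w ψ, coeFn_displacement_displacement w z ψ,
    Lp.coeFn_smul (symplecticCharacter z w) (displacement w (displacement z ψ))] with x h₁ h₂ h₃
  rw [h₁, h₃, Pi.smul_apply, h₂, displacementFun_displacementFun, smul_eq_mul]

theorem inner_displacement_conj (z w : ℂ) (φ ψ : StateSpace) :
    ⟪displacement w φ, displacement z (displacement w ψ)⟫_ℂ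
      = symplecticCharacter z w * ⟪φ, displacement z ψ⟫_ℂ := by
  rw [displacement_displacement, inner_smul_right, (displacement w).inner_map_map]

end Displacement

section Tensor

variable {D E : Type*} [NormedAddCommGroup D] [NormedSpace ℝ D] [NormedAddCommGroup E]
  [NormedSpace ℝ E]

theorem norm_iteratedFDeriv_comp_fst_le (φ : 𝓢(D, ℂ)) (n : ℕ) (x : D × E) :
    ‖iteratedFDeriv ℝ n (fun x : D × E => φ x.1) x‖ ≤ ‖iteratedFDeriv ℝ n φ x.1‖ := by
  have h := (ContinuousLinearMap.fst ℝ D E).iteratedFDeriv_comp_right (φ.smooth n) x le_rfl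
  rw [show (fun x : D × E => φ x.1) = φ ∘ ContinuousLinearMap.fst ℝ D E from rfl, h]
  refine (ContinuousMultilinearMap.norm_compContinuousLinearMap_le _ _).trans
    (mul_le_of_le_one_right (norm_nonneg _) (Finset.prod_le_one (fun _ _ => norm_nonneg _) ?_))
  exact fun _ _ => ContinuousLinearMap.norm_fst_le _ _ _

theorem norm_iteratedFDeriv_comp_snd_le (ψ : 𝓢(E, ℂ)) (n : ℕ) (x : D × E) :
    ‖iteratedFDeriv ℝ n (fun x : D × E => ψ x.2) x‖ ≤ ‖iteratedFDeriv ℝ n ψ x.2‖ := by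
  have h := (ContinuousLinearMap.snd ℝ D E).iteratedFDeriv_comp_right (ψ.smooth n) x le_rfl
  rw [show (fun x : D × E => ψ x.2) = ψ ∘ ContinuousLinearMap.snd ℝ D E from rfl, h]
  refine (ContinuousMultilinearMap.norm_compContinuousLinearMap_le _ _).trans
    (mul_le_of_le_one_right (norm_nonneg _) (Finset.prod_le_one (fun _ _ => norm_nonneg _) ?_))
  exact fun _ _ => ContinuousLinearMap.norm_snd_le _ _ _

theorem norm_pow_mul_iteratedFDeriv_mul_le (φ : 𝓢(D, ℂ)) (ψ : 𝓢(E, ℂ)) (k i j : ℕ) (x : D × E) :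
    ‖x‖ ^ k * (‖iteratedFDeriv ℝ i φ x.1‖ * ‖iteratedFDeriv ℝ j ψ x.2‖)
      ≤ SchwartzMap.seminorm ℝ k i φ * SchwartzMap.seminorm ℝ 0 j ψ
        + SchwartzMap.seminorm ℝ 0 i φ * SchwartzMap.seminorm ℝ k j ψ := by
  have hφ := φ.norm_iteratedFDeriv_le_seminorm ℝ i x.1
  have hψ := ψ.norm_iteratedFDeriv_le_seminorm ℝ j x.2
  have hkφ := φ.le_seminorm ℝ k i x.1
  have hkψ := ψ.le_seminorm ℝ k j x.2
  have hpow : ‖x‖ ^ k ≤ ‖x.1‖ ^ k + ‖x.2‖ ^ k := by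
    rcases max_choice ‖x.1‖ ‖x.2‖ with h | h <;> rw [Prod.norm_def, h]
    · exact le_add_of_nonneg_right (by positivity)
    · exact le_add_of_nonneg_left (by positivity)
  calc ‖x‖ ^ k * (‖iteratedFDeriv ℝ i φ x.1‖ * ‖iteratedFDeriv ℝ j ψ x.2‖)
      ≤ (‖x.1‖ ^ k + ‖x.2‖ ^ k) *
          (‖iteratedFDeriv ℝ i φ x.1‖ * ‖iteratedFDeriv ℝ j ψ x.2‖) := by gcongr
    _ = (‖x.1‖ ^ k * ‖iteratedFDeriv ℝ i φ x.1‖) * ‖iteratedFDeriv ℝ j ψ x.2‖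
        + ‖iteratedFDeriv ℝ i φ x.1‖ * (‖x.2‖ ^ k * ‖iteratedFDeriv ℝ j ψ x.2‖) := by ring
    _ ≤ _ := by gcongr

/-- The tensor product of two Schwartz functions. -/
def schwartzTensor (φ : 𝓢(D, ℂ)) (ψ : 𝓢(E, ℂ)) : 𝓢(D × E, ℂ) where
  toFun x := φ x.1 * ψ x.2
  smooth' := (φ.smooth'.comp contDiff_fst).mul (ψ.smooth'.comp contDiff_snd)
  decay' k n := by
    refine ⟨∑ i ∈ Finset.range (n + 1), (n.choose i : ℝ) *
      (SchwartzMap.seminorm ℝ k i φ * SchwartzMap.seminorm ℝ 0 (n - i) ψ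
        + SchwartzMap.seminorm ℝ 0 i φ * SchwartzMap.seminorm ℝ k (n - i) ψ), fun x => ?_⟩
    have hprod := norm_iteratedFDeriv_mul_le (𝕜 := ℝ) (n := n) (N := n)
      ((φ.smooth n).comp contDiff_fst) ((ψ.smooth n).comp contDiff_snd) x le_rfl
    calc _ ≤ ‖x‖ ^ k * ∑ i ∈ Finset.range (n + 1), (n.choose i : ℝ)
            * ‖iteratedFDeriv ℝ i φ x.1‖ * ‖iteratedFDeriv ℝ (n - i) ψ x.2‖ := by
          refine mul_le_mul_of_nonneg_left (hprod.trans (Finset.sum_le_sum fun i _ => ?_))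
            (by positivity)
          gcongr
          · exact norm_iteratedFDeriv_comp_fst_le φ i x
          · exact norm_iteratedFDeriv_comp_snd_le ψ (n - i) x
      _ = ∑ i ∈ Finset.range (n + 1), (n.choose i : ℝ) *
            (‖x‖ ^ k * (‖iteratedFDeriv ℝ i φ x.1‖ * ‖iteratedFDeriv ℝ (n - i) ψ x.2‖)) := by
          rw [Finset.mul_sum]
          exact Finset.sum_congr rfl fun i _ => by ring
      _ ≤ _ := Finset.sum_le_sum fun i _ => mul_le_mul_of_nonneg_left
          (norm_pow_mul_iteratedFDeriv_mul_le φ ψ k i (n - i) x) (Nat.cast_nonneg _)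

end Tensor

section Ambiguity

/-- The pointwise complex conjugate of a Schwartz function. -/
def schwartzConj (φ : 𝓢(ℝ, ℂ)) : 𝓢(ℝ, ℂ) :=
  φ.postcompCLM (𝕜 := ℝ) (Complex.conjCLE : ℂ →L[ℝ] ℂ)

theorem schwartzConj_apply (φ : 𝓢(ℝ, ℂ)) (x : ℝ) : schwartzConj φ x = star (φ x) := rfl

/-- The product `conj φ · ψ` of Schwartz functions. -/
def conjMul (φ ψ : 𝓢(ℝ, ℂ)) : 𝓢(ℝ, ℂ) :=
  pairing (ContinuousLinearMap.mul ℂ ℂ) (schwartzConj φ) ψ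

theorem conjMul_apply (φ ψ : 𝓢(ℝ, ℂ)) (x : ℝ) : conjMul φ ψ x = star (φ x) * ψ x := rfl

/-- The cross-ambiguity function `⟨φ, D(z) ψ⟩`. -/
def ambiguity (φ ψ : 𝓢(ℝ, ℂ)) (z : ℂ) : ℂ := ∫ x : ℝ, star (φ x) * displacementFun z ψ x

theorem inner_displacement_vec (φ ψ : 𝓢(ℝ, ℂ)) (z : ℂ) :
    ⟪vec φ, displacement z (vec ψ)⟫_ℂ = ambiguity φ ψ z :=
  inner_vec_eq_integral φ
    ((coeFn_displacement z _).trans (displacementFun_congr z (coeFn_vec ψ)))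

theorem integrable_star_mul_displacementFun (φ ψ : 𝓢(ℝ, ℂ)) (z : ℂ) :
    Integrable fun x : ℝ => star (φ x) * displacementFun z ψ x := by
  refine ((conjMul φ (schwartzDisplacement z ψ)).integrable (μ := volume)).congr
    (Eventually.of_forall fun x => ?_)
  rw [conjMul_apply, schwartzDisplacement_apply]

/-- The function `conj (φ x) (𝓕 ψ k) exp (2πi x k)` of `x + i k`. Up to a phase and a linear
change of variables, its Fourier transform is the ambiguity function of `φ` and `ψ`. -/
def chirpedTensor (φ ψ : 𝓢(ℝ, ℂ)) : 𝓢(ℂ, ℂ) :=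
  smulLeftCLM ℂ (fun w : ℂ => Complex.exp ((2 * π * (w.re * w.im) : ℝ) * I))
    (compCLMOfContinuousLinearEquiv ℂ Complex.equivRealProdCLM
      (schwartzTensor (schwartzConj φ) (𝓕 ψ)))

theorem hasTemperateGrowth_re : Complex.re.HasTemperateGrowth :=
  Complex.reCLM.hasTemperateGrowth

theorem hasTemperateGrowth_im : Complex.im.HasTemperateGrowth :=
  Complex.imCLM.hasTemperateGrowth

theorem chirpedTensor_mk (φ ψ : 𝓢(ℝ, ℂ)) (x k : ℝ) :
    chirpedTensor φ ψ ⟨x, k⟩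
      = Complex.exp ((2 * π * (x * k) : ℝ) * I) * (star (φ x) * 𝓕 ψ k) := by
  have hre := hasTemperateGrowth_re
  have him := hasTemperateGrowth_im
  rw [chirpedTensor, smulLeftCLM_apply_apply (hasTemperateGrowth_cexp_comp (by fun_prop))]
  rfl

theorem fourier_chirpedTensor (φ ψ : 𝓢(ℝ, ℂ)) (s t : ℝ) :
    𝓕 (chirpedTensor φ ψ) ⟨s, t⟩
      = ∫ x, Complex.exp (((-2 * π * (x * s) : ℝ) : ℂ) * I) * (star (φ x) * ψ (x - t)) := by
  have hinv : ∀ y, ψ y = ∫ k, Complex.exp (((2 * π * (k * y) : ℝ) : ℂ) * I) * 𝓕 ψ k := fun y => by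
    conv_lhs => rw [← FourierPair.fourierInv_fourier_eq (F := 𝓢(ℝ, ℂ)) ψ]
    rw [fourierInv_coe, Real.fourierInv_eq']
    simp [mul_comm]
  have hint := (Real.fourierIntegral_convergent_iff (⟨s, t⟩ : ℂ)).2
    ((chirpedTensor φ ψ).integrable (μ := volume))
  rw [fourier_coe, Real.fourier_eq, integral_complex_eq, integral_prod]
  · refine integral_congr_ae (Eventually.of_forall fun x => ?_)
    simp only
    rw [hinv, ← integral_const_mul, ← integral_const_mul]
    refine integral_congr_ae (Eventually.of_forall fun k => ?_)
    simp only [chirpedTensor_mk, Circle.smul_def, smul_eq_mul, Real.fourierChar_apply]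
    have hphase : Complex.exp ((2 * π * -⟪(⟨x, k⟩ : ℂ), ⟨s, t⟩⟫_ℝ : ℝ) * I)
          * Complex.exp ((2 * π * (x * k) : ℝ) * I)
        = Complex.exp ((-2 * π * (x * s) : ℝ) * I)
          * Complex.exp ((2 * π * (k * (x - t)) : ℝ) * I) := by
      rw [← Complex.exp_add, ← Complex.exp_add]
      congr 1
      simp only [Complex.inner, Complex.mul_re, Complex.conj_re, Complex.conj_im, mul_neg,
        sub_neg_eq_add, neg_add_rev, Complex.ofReal_mul, Complex.ofReal_ofNat, Complex.ofReal_add,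
        Complex.ofReal_neg, neg_mul, Complex.ofReal_sub]
      ring
    linear_combination (star (φ x) * 𝓕 ψ k) * hphase
  · exact integrable_complex_iff.1 hint

theorem ambiguity_eq_fourier_chirpedTensor (φ ψ : 𝓢(ℝ, ℂ)) (z : ℂ) :
    ambiguity φ ψ z = Complex.exp (((-(momentum z * position z * 2⁻¹) : ℝ) : ℂ) * I) *
      𝓕 (chirpedTensor φ ψ) ⟨-(2 * π)⁻¹ * momentum z, position z⟩ := by
  rw [fourier_chirpedTensor, ambiguity, ← integral_const_mul]
  refine integral_congr_ae (Eventually.of_forall fun x => ?_)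
  simp only [displacementFun]
  rw [← mul_assoc (Complex.exp _), ← Complex.exp_add, mul_left_comm]
  congr 2
  rw [← add_mul, ← Complex.ofReal_add]
  congr 2
  field_simp
  ring

theorem hasTemperateGrowth_position : position.HasTemperateGrowth := by
  have hre := hasTemperateGrowth_re
  unfold position
  fun_prop

theorem hasTemperateGrowth_momentum : momentum.HasTemperateGrowth := by
  have him := hasTemperateGrowth_im
  unfold momentum
  fun_prop

theorem norm_le_abs_position_add_abs_momentum (z : ℂ) : ‖z‖ ≤ |position z| + |momentum z| := by
  have hsqrt : 1 ≤ √2 := Real.one_le_sqrt.2 (by norm_num)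
  rw [position, momentum, abs_mul, abs_mul, abs_of_nonneg (Real.sqrt_nonneg 2), ← mul_add]
  exact (Complex.norm_le_abs_re_add_abs_im z).trans
    (le_mul_of_one_le_left (by positivity) hsqrt)

/-- The linear change of variables `z ↦ (-p / 2π) + i q` which turns the Fourier transform of
`chirpedTensor φ ψ` into the ambiguity function of `φ` and `ψ`. -/
def ambiguityFrequency : ℂ →L[ℝ] ℂ :=
  Complex.equivRealProdCLM.symm.toContinuousLinearMap ∘L
    ((-(2 * π)⁻¹ * √2) • Complex.imCLM).prod (√2 • Complex.reCLM)

theorem ambiguityFrequency_apply (z : ℂ) :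
    ambiguityFrequency z = ⟨-(2 * π)⁻¹ * momentum z, position z⟩ := by
  rw [momentum, ← mul_assoc]
  rfl

theorem norm_le_norm_ambiguityFrequency (z : ℂ) :
    ‖z‖ ≤ (2 * π + 1) * ‖ambiguityFrequency z‖ := by
  have hre := Complex.abs_re_le_norm (ambiguityFrequency z)
  have him := Complex.abs_im_le_norm (ambiguityFrequency z)
  simp only [ambiguityFrequency_apply] at hre him ⊢
  rw [abs_mul, abs_neg, abs_of_pos (by positivity), inv_mul_le_iff₀ (by positivity)] at hre
  linarith [norm_le_abs_position_add_abs_momentum z]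

/-- The cross-ambiguity function as a Schwartz function on phase space. -/
def schwartzAmbiguity (φ ψ : 𝓢(ℝ, ℂ)) : 𝓢(ℂ, ℂ) :=
  smulLeftCLM ℂ (fun z => Complex.exp (((-(momentum z * position z * 2⁻¹) : ℝ) : ℂ) * I))
    (compCLM ℂ ambiguityFrequency.hasTemperateGrowth
      ⟨1, 2 * π + 1, fun z => by
        rw [pow_one]
        exact (norm_le_norm_ambiguityFrequency z).trans
          (mul_le_mul_of_nonneg_left (le_add_of_nonneg_left zero_le_one) (by positivity))⟩
      (𝓕 (chirpedTensor φ ψ)))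

theorem schwartzAmbiguity_apply (φ ψ : 𝓢(ℝ, ℂ)) (z : ℂ) :
    schwartzAmbiguity φ ψ z = ambiguity φ ψ z := by
  have hq := hasTemperateGrowth_position
  have hp := hasTemperateGrowth_momentum
  rw [schwartzAmbiguity, smulLeftCLM_apply_apply (hasTemperateGrowth_cexp_comp (by fun_prop)),
    ambiguity_eq_fourier_chirpedTensor, ← ambiguityFrequency_apply]
  rfl

end Ambiguity

section PhaseSpaceMoments

/-- The position operator on Schwartz functions. -/
def schwartzPosition (φ : 𝓢(ℝ, ℂ)) : 𝓢(ℝ, ℂ) := smulLeftCLM ℂ (fun x : ℝ => (x : ℂ)) φ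

theorem schwartzPosition_apply (φ : 𝓢(ℝ, ℂ)) (x : ℝ) : schwartzPosition φ x = x * φ x := by
  rw [schwartzPosition, smulLeftCLM_apply_apply Function.Complex.hasTemperateGrowth_ofReal]
  rfl

theorem position_mul_ambiguity (φ ψ : 𝓢(ℝ, ℂ)) (z : ℂ) :
    (position z : ℂ) * ambiguity φ ψ z
      = ambiguity (schwartzPosition φ) ψ z - ambiguity φ (schwartzPosition ψ) z := by
  rw [ambiguity, ambiguity, ambiguity, ← integral_const_mul, ← integral_sub
    (integrable_star_mul_displacementFun _ _ _) (integrable_star_mul_displacementFun _ _ _)]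
  refine integral_congr_ae (Eventually.of_forall fun x => ?_)
  simp only [displacementFun, schwartzPosition_apply, star_mul', Complex.star_def,
    Complex.conj_ofReal]
  push_cast
  ring

theorem hasDerivAt_displacementFun (ψ : 𝓢(ℝ, ℂ)) (z : ℂ) (x : ℝ) :
    HasDerivAt (displacementFun z ψ) (I * momentum z * displacementFun z ψ x
      + displacementFun z (derivCLM ℂ ℂ ψ) x) x := by
  have hphase : HasDerivAt (fun x : ℝ => ((momentum z * (x - position z / 2) : ℝ) : ℂ) * I)
      ((momentum z : ℂ) * I) x := by
    have := (((hasDerivAt_id x).sub_const (position z / 2)).const_mul (momentum z)).ofReal_comp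
    simpa using this.mul_const I
  have hψ : HasDerivAt (fun x : ℝ => ψ (x - position z)) (deriv ψ (x - position z)) x :=
    (ψ.hasDerivAt (x - position z)).comp_sub_const x (position z)
  refine (hphase.cexp.mul hψ).congr_deriv ?_
  simp only [displacementFun, derivCLM_apply]
  ring

theorem momentum_mul_ambiguity (φ ψ : 𝓢(ℝ, ℂ)) (z : ℂ) :
    (momentum z : ℂ) * ambiguity φ ψ z
      = I * (ambiguity (derivCLM ℂ ℂ φ) ψ z + ambiguity φ (derivCLM ℂ ℂ ψ) z) := by
  have hφ : ∀ x, HasDerivAt (fun x => star (φ x)) (star (derivCLM ℂ ℂ φ x)) x := fun x => by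
    rw [derivCLM_apply]
    exact (φ.hasDerivAt x).star
  have i₁ := integrable_star_mul_displacementFun φ ψ z
  have i₂ := integrable_star_mul_displacementFun φ (derivCLM ℂ ℂ ψ) z
  have hsplit : (fun x => star (φ x) * (I * momentum z * displacementFun z ψ x
      + displacementFun z (derivCLM ℂ ℂ ψ) x))
      = fun x => I * momentum z * (star (φ x) * displacementFun z ψ x)
        + star (φ x) * displacementFun z (derivCLM ℂ ℂ ψ) x := by
    funext x; ring
  have hparts := integral_mul_deriv_eq_deriv_mul_of_integrable (fun x _ => hφ x)
    (fun x _ => hasDerivAt_displacementFun ψ z x)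
    (show Integrable (fun x => star (φ x) * (I * momentum z * displacementFun z ψ x
      + displacementFun z (derivCLM ℂ ℂ ψ) x)) by rw [hsplit]; exact (i₁.const_mul _).add i₂)
    (integrable_star_mul_displacementFun _ _ _) i₁
  rw [hsplit, integral_add (i₁.const_mul _) i₂, integral_const_mul] at hparts
  change _ * ambiguity φ ψ z + ambiguity φ _ z = -ambiguity _ ψ z at hparts
  linear_combination (-I) * hparts + (momentum z * ambiguity φ ψ z) * Complex.I_sq

variable {ϖ : ℂ → ℂ}

theorem integrable_position_mul_ambiguity
    (hϖ : ∀ φ ψ : 𝓢(ℝ, ℂ), Integrable fun z => ϖ z * ambiguity φ ψ z) (φ ψ : 𝓢(ℝ, ℂ)) :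
    Integrable fun z => ϖ z * position z * ambiguity φ ψ z := by
  refine ((hϖ (schwartzPosition φ) ψ).sub (hϖ φ (schwartzPosition ψ))).congr
    (Eventually.of_forall fun z => ?_)
  simp only [Pi.sub_apply]
  rw [mul_assoc, position_mul_ambiguity, mul_sub]

theorem integrable_momentum_mul_ambiguity
    (hϖ : ∀ φ ψ : 𝓢(ℝ, ℂ), Integrable fun z => ϖ z * ambiguity φ ψ z) (φ ψ : 𝓢(ℝ, ℂ)) :
    Integrable fun z => ϖ z * momentum z * ambiguity φ ψ z := by
  refine (((hϖ (derivCLM ℂ ℂ φ) ψ).add (hϖ φ (derivCLM ℂ ℂ ψ))).const_mul I).congr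
    (Eventually.of_forall fun z => ?_)
  simp only [Pi.add_apply]
  rw [mul_assoc, momentum_mul_ambiguity]
  ring

theorem sq_norm_eq_position_sq_add_momentum_sq (z : ℂ) :
    ‖z‖ ^ 2 = (position z ^ 2 + momentum z ^ 2) / 2 := by
  rw [Complex.sq_norm, Complex.normSq_apply, position, momentum, mul_pow, mul_pow,
    Real.sq_sqrt zero_le_two]
  ring

theorem integrable_sq_norm_mul_ambiguity
    (hϖ : ∀ φ ψ : 𝓢(ℝ, ℂ), Integrable fun z => ϖ z * ambiguity φ ψ z) (φ ψ : 𝓢(ℝ, ℂ)) :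
    Integrable fun z : ℂ => ‖z‖ ^ 2 * ‖ϖ z * ambiguity φ ψ z‖ := by
  have hq := integrable_position_mul_ambiguity (integrable_position_mul_ambiguity hϖ) φ ψ
  have hp := integrable_momentum_mul_ambiguity (integrable_momentum_mul_ambiguity hϖ) φ ψ
  refine ((hq.add hp).norm.div_const 2).congr (Eventually.of_forall fun z => ?_)
  have hsum : ϖ z * position z * position z * ambiguity φ ψ z
      + ϖ z * momentum z * momentum z * ambiguity φ ψ z
      = ((position z ^ 2 + momentum z ^ 2 : ℝ) : ℂ) * (ϖ z * ambiguity φ ψ z) := by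
    push_cast
    ring
  simp only [Pi.add_apply]
  rw [hsum, norm_mul, Complex.norm_of_nonneg (by positivity),
    sq_norm_eq_position_sq_add_momentum_sq, div_mul_eq_mul_div]

theorem integrable_norm_mul_ambiguity
    (hϖ : ∀ φ ψ : 𝓢(ℝ, ℂ), Integrable fun z => ϖ z * ambiguity φ ψ z) (φ ψ : 𝓢(ℝ, ℂ)) :
    Integrable fun z : ℂ => ‖z‖ * ‖ϖ z * ambiguity φ ψ z‖ := by
  refine ((hϖ φ ψ).norm.add (integrable_sq_norm_mul_ambiguity hϖ φ ψ)).mono'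
    (continuous_norm.aestronglyMeasurable.mul (hϖ φ ψ).1.norm) (Eventually.of_forall fun z => ?_)
  have hz : ‖z‖ ≤ 1 + ‖z‖ ^ 2 := by nlinarith [sq_nonneg (‖z‖ - 1)]
  rw [norm_mul, norm_norm, norm_norm, Pi.add_apply]
  calc ‖z‖ * ‖ϖ z * ambiguity φ ψ z‖ ≤ (1 + ‖z‖ ^ 2) * ‖ϖ z * ambiguity φ ψ z‖ := by gcongr
    _ = _ := by ring

end PhaseSpaceMoments

section Axes

theorem ambiguity_mul_I (φ ψ : 𝓢(ℝ, ℂ)) (t : ℝ) :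
    ambiguity φ ψ ((t / √2 : ℝ) * I)
      = ∫ x, Complex.exp (((t * x : ℝ) : ℂ) * I) * conjMul φ ψ x := by
  refine integral_congr_ae (Eventually.of_forall fun x => ?_)
  simp [displacementFun, position, momentum, conjMul_apply, mul_div_cancel₀, mul_left_comm]

theorem fourier_compSubConstCLM (ψ : 𝓢(ℝ, ℂ)) (t ξ : ℝ) :
    𝓕 (compSubConstCLM ℂ t ψ) ξ
      = Complex.exp (((-2 * π * (t * ξ) : ℝ) : ℂ) * I) * 𝓕 ψ ξ := by
  rw [fourier_coe, fourier_coe, Real.fourier_eq', Real.fourier_eq', ← integral_const_mul,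
    ← integral_add_right_eq_self _ t]
  refine integral_congr_ae (Eventually.of_forall fun u => ?_)
  simp only [compSubConstCLM_apply, add_sub_cancel_right, smul_eq_mul, ← mul_assoc,
    ← Complex.exp_add]
  congr 2
  simp only [neg_mul, RCLike.inner_apply, Real.ringHom_apply, Complex.ofReal_neg,
    Complex.ofReal_mul, Complex.ofReal_ofNat, Complex.ofReal_add]
  ring

theorem fourier_comp_div {E : Type*} [NormedAddCommGroup E] [NormedSpace ℂ E] (g : ℝ → E) {r : ℝ}
    (hr : 0 < r) (s : ℝ) : 𝓕 (fun t => g (t / r)) s = r • 𝓕 g (r * s) := by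
  rw [Real.fourier_eq, Real.fourier_eq]
  have h := Measure.integral_comp_div
    (fun t => Real.fourierChar (-⟪t, r * s⟫_ℝ) • g t) r
  rw [abs_of_pos hr] at h
  rw [← h]
  refine integral_congr_ae (Eventually.of_forall fun t => ?_)
  simp only [RCLike.inner_apply, conj_trivial]
  rw [show r * s * (t / r) = s * t by field_simp]

theorem ambiguity_neg_ofReal (φ ψ : 𝓢(ℝ, ℂ)) (t : ℝ) :
    ambiguity φ ψ ((t / √2 : ℝ) * (-1))
      = ∫ ξ, Complex.exp (((t * (2 * π * ξ) : ℝ) : ℂ) * I) * conjMul (𝓕 φ) (𝓕 ψ) ξ := by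
  have htranslate : ambiguity φ ψ ((t / √2 : ℝ) * (-1))
      = ∫ x, ⟪φ x, compSubConstCLM ℂ (-t) ψ x⟫_ℂ := by
    refine integral_congr_ae (Eventually.of_forall fun x => ?_)
    simp [displacementFun, position, momentum, mul_div_cancel₀, mul_comm]
  rw [htranslate, ← integral_inner_fourier_fourier]
  refine integral_congr_ae (Eventually.of_forall fun ξ => ?_)
  simp only [fourier_compSubConstCLM, conjMul_apply, RCLike.inner_apply', Complex.star_def]
  rw [mul_left_comm, show -2 * π * (-t * ξ) = t * (2 * π * ξ) by ring]

end Axes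

section SymplecticFourier

variable {ϖ : ℂ → ℂ} {M : StateSpace →L[ℂ] StateSpace}

theorem integrable_weight_mul_ambiguity (hM : IsOperatorOfWeight ϖ M) (φ ψ : 𝓢(ℝ, ℂ)) :
    Integrable fun z => ϖ z * ambiguity φ ψ z := by
  simpa only [inner_displacement_vec] using (hM φ ψ).1

/-- The point `-πi ξ` of phase space at which the symplectic Fourier transform is the ordinary
Fourier transform at `ξ`. -/
def phasePoint (ξ : ℂ) : ℂ := -(π * I) * ξ

theorem symplecticCharacter_neg_phasePoint (z ξ : ℂ) :
    symplecticCharacter z (-phasePoint ξ) = Real.fourierChar (-⟪z, ξ⟫_ℝ) := by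
  rw [Real.fourierChar_apply, symplecticCharacter, phasePoint]
  congr 2
  simp only [neg_mul, neg_neg, star_mul', RCLike.star_def, Complex.conj_ofReal, Complex.conj_I,
    mul_neg, Complex.neg_im, Complex.mul_im, Complex.mul_re, Complex.ofReal_re, Complex.I_re,
    mul_zero, Complex.ofReal_im, Complex.I_im, mul_one, sub_self, Complex.conj_re, zero_mul,
    add_zero, Complex.conj_im, sub_neg_eq_add, zero_add, neg_zero, neg_add_rev, Complex.ofReal_mul,
    Complex.ofReal_ofNat, Complex.ofReal_add, Complex.ofReal_neg, Complex.inner]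
  ring

/-- By covariance, conjugation of `M` by displacement operators modulates the weight by symplectic
characters. -/
theorem inner_displaced_phasePoint (hM : IsOperatorOfWeight ϖ M) (φ ψ : 𝓢(ℝ, ℂ)) (ξ : ℂ) :
    ⟪vec φ, displaced M (phasePoint ξ) (vec ψ)⟫_ℂ
      = (π : ℂ)⁻¹ * 𝓕 (fun z => ϖ z * ambiguity φ ψ z) ξ := by
  rw [inner_displaced, displacement_vec, displacement_vec, (hM _ _).2, Real.fourier_eq]
  congr 1
  refine integral_congr_ae (Eventually.of_forall fun z => ?_)
  simp only
  rw [← displacement_vec, ← displacement_vec, inner_displacement_conj,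
    symplecticCharacter_neg_phasePoint, inner_displacement_vec, mul_left_comm, Circle.smul_def,
    smul_eq_mul]

theorem formIntegrand_phasePoint (hM : IsOperatorOfWeight ϖ M) (F : ℂ → ℂ) (φ ψ : 𝓢(ℝ, ℂ))
    (ξ : ℂ) : formIntegrand M F (vec φ) (vec ψ) (phasePoint ξ)
      = (π : ℂ)⁻¹ * (F (phasePoint ξ) * 𝓕 (fun z => ϖ z * ambiguity φ ψ z) ξ) := by
  rw [formIntegrand, inner_displaced_phasePoint hM, mul_left_comm]

theorem phasePoint_eq_smul (ξ : ℂ) : phasePoint ξ = -I * (π • ξ) := by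
  rw [phasePoint, Complex.real_smul]
  ring

theorem integrable_comp_phasePoint_iff {F : ℂ → ℂ} :
    Integrable (fun ξ => F (phasePoint ξ)) ↔ Integrable F := by
  simp only [phasePoint_eq_smul]
  rw [integrable_comp_smul_iff volume (fun z => F (-I * z)) Real.pi_ne_zero]
  exact (measurePreserving_mul_left (by simp)).integrable_comp_emb
    (measurableEmbedding_mulLeft₀ (by simp))

theorem integral_eq_integral_comp_phasePoint (F : ℂ → ℂ) :
    ∫ z, F z = (π : ℂ) ^ 2 * ∫ ξ, F (phasePoint ξ) := by
  simp only [phasePoint_eq_smul]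
  rw [Measure.integral_comp_smul volume (fun z => F (-I * z)),
    (measurePreserving_mul_left (by simp)).integral_comp (measurableEmbedding_mulLeft₀ (by simp)),
    Complex.finrank_real_complex, abs_of_pos (by positivity), Complex.real_smul]
  push_cast
  rw [mul_inv_cancel_left₀ (by simp [Real.pi_ne_zero])]

theorem integrable_formIntegrand_iff (hM : IsOperatorOfWeight ϖ M) (F : ℂ → ℂ)
    (φ ψ : 𝓢(ℝ, ℂ)) :
    Integrable (formIntegrand M F (vec φ) (vec ψ)) ↔
      Integrable fun ξ => F (phasePoint ξ) * 𝓕 (fun z => ϖ z * ambiguity φ ψ z) ξ := by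
  rw [← integrable_comp_phasePoint_iff]
  simp only [formIntegrand_phasePoint hM]
  exact integrable_const_mul_iff (by simp [Real.pi_ne_zero]) _

theorem quantForm_vec_eq (hM : IsOperatorOfWeight ϖ M) (F : ℂ → ℂ) (φ ψ : 𝓢(ℝ, ℂ)) :
    quantForm M F (vec φ) (vec ψ)
      = ∫ ξ, F (phasePoint ξ) * 𝓕 (fun z => ϖ z * ambiguity φ ψ z) ξ := by
  have hπ : (π : ℂ) ≠ 0 := Complex.ofReal_ne_zero.2 Real.pi_ne_zero
  rw [quantForm, integral_eq_integral_comp_phasePoint]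
  simp only [formIntegrand_phasePoint hM]
  rw [integral_const_mul]
  field_simp

end SymplecticFourier

section Quadratures

/-- A quadrature, such as position or momentum: the observable generating the displacements
`D(z)` along a line `ℝ u` of phase space, together with a unitary transformation that diagonalizes
it. -/
structure Quadrature where
  /-- The direction `u` of the displacements. -/
  axis : ℂ
  norm_axis : ‖axis‖ = 1
  im_sq_axis : (axis ^ 2).im = 0
  /-- The transformation that turns the observable into a multiplication operator. -/
  unitary : StateSpace ≃ₗᵢ[ℂ] StateSpace
  /-- The restriction of `unitary` to Schwartz functions. -/
  transform : 𝓢(ℝ, ℂ) ≃L[ℂ] 𝓢(ℝ, ℂ)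
  unitary_vec : ∀ φ, unitary (vec φ) = vec (transform φ)
  /-- The observable becomes multiplication by `scale * x`. -/
  scale : ℝ
  scale_pos : 0 < scale
  ambiguity_axis : ∀ φ ψ (t : ℝ), ambiguity φ ψ ((t / √2 : ℝ) * axis)
    = ∫ x, Complex.exp (((t * (scale * x) : ℝ) : ℂ) * I) * conjMul (transform φ) (transform ψ) x

/-- The position operator. -/
def positionQuadrature : Quadrature where
  axis := I
  norm_axis := Complex.norm_I
  im_sq_axis := by rw [Complex.I_sq, Complex.neg_im, Complex.one_im, neg_zero]
  unitary := .refl ℂ StateSpace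
  transform := .refl ℂ _
  unitary_vec _ := rfl
  scale := 1
  scale_pos := one_pos
  ambiguity_axis φ ψ t := by
    simp only [one_mul]
    exact ambiguity_mul_I φ ψ t

/-- The momentum operator. -/
def momentumQuadrature : Quadrature where
  axis := -1
  norm_axis := by rw [norm_neg, norm_one]
  im_sq_axis := by rw [neg_one_sq, Complex.one_im]
  unitary := Lp.fourierTransformₗᵢ ℝ ℂ
  transform := FourierTransform.fourierCLE ℂ 𝓢(ℝ, ℂ)
  unitary_vec := toLp_fourier_eq
  scale := 2 * π
  scale_pos := Real.two_pi_pos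
  ambiguity_axis := ambiguity_neg_ofReal

namespace Quadrature

variable (X : Quadrature)

/-- The classical observable on phase space that corresponds to a quadrature. -/
def coordinate (z : ℂ) : ℝ := √2 * ⟪X.axis, I * z⟫_ℝ

/-- The function `f` of a quadrature operator, as an unbounded operator on its maximal domain. -/
def functionOf (f : ℝ → ℂ) : StateSpace →ₗ.[ℂ] StateSpace :=
  ((multiplicationGraph fun x => f (X.scale * x)).comap
    (X.unitary.toLinearEquiv.toLinearMap.prodMap X.unitary.toLinearEquiv.toLinearMap)).toLinearPMap

end Quadrature

theorem coordinate_positionQuadrature : positionQuadrature.coordinate = position := by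
  funext z
  simp [Quadrature.coordinate, positionQuadrature, position, Complex.inner]

theorem coordinate_momentumQuadrature : momentumQuadrature.coordinate = momentum := by
  funext z
  simp [Quadrature.coordinate, momentumQuadrature, momentum, Complex.inner]

theorem functionOf_positionQuadrature : positionQuadrature.functionOf = functionOfQ := by
  funext f
  simp only [Quadrature.functionOf, positionQuadrature, one_mul]
  rfl

theorem functionOf_momentumQuadrature : momentumQuadrature.functionOf = functionOfP := rfl

namespace Quadrature

variable (X : Quadrature)

theorem coordinate_phasePoint (ξ : ℂ) :
    X.coordinate (phasePoint ξ) = √2 * π * ⟪X.axis, ξ⟫_ℝ := by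
  have hrot : I * phasePoint ξ = π • ξ := by
    rw [phasePoint_eq_smul, ← mul_assoc, mul_neg, Complex.I_mul_I, neg_neg, one_mul]
  rw [coordinate, hrot, real_inner_smul_right, mul_assoc]

theorem measurable_coordinate : Measurable X.coordinate := by
  unfold coordinate
  fun_prop

theorem abs_coordinate_le (z : ℂ) : |X.coordinate z| ≤ √2 * ‖z‖ := by
  have h := abs_real_inner_le_norm X.axis (I * z)
  rw [X.norm_axis, one_mul, norm_mul, Complex.norm_I, one_mul] at h
  rw [coordinate, abs_mul, abs_of_nonneg (Real.sqrt_nonneg 2)]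
  gcongr

theorem im_sq_ofReal_mul_axis (t : ℝ) : ((t * X.axis) ^ 2).im = 0 := by
  rw [mul_pow, ← Complex.ofReal_pow, Complex.im_ofReal_mul, X.im_sq_axis, mul_zero]

theorem ambiguity_mul_axis (φ ψ : 𝓢(ℝ, ℂ)) (t : ℝ) :
    ambiguity φ ψ (t * X.axis)
      = 𝓕⁻ (conjMul (X.transform φ) (X.transform ψ)) (t / (√2 * π / X.scale)) := by
  have hscale := X.scale_pos.ne'
  have h := X.ambiguity_axis φ ψ (√2 * t)
  rw [mul_div_cancel_left₀ t (by positivity)] at h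
  rw [h, fourierInv_coe, Real.fourierInv_eq']
  refine integral_congr_ae (Eventually.of_forall fun x => ?_)
  have hsq : √2 ^ 2 = (2 : ℝ) := Real.sq_sqrt zero_le_two
  have hphase : √2 * t * (X.scale * x) = 2 * π * ⟪x, t / (√2 * π / X.scale)⟫_ℝ := by
    simp only [RCLike.inner_apply, conj_trivial]
    field_simp
    linear_combination t * x * hsq
  simp only [hphase, smul_eq_mul]

theorem fourier_ambiguity_mul_axis (φ ψ : 𝓢(ℝ, ℂ)) (s : ℝ) :
    𝓕 (fun t : ℝ => ambiguity φ ψ (t * X.axis)) s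
      = (√2 * π / X.scale : ℝ) *
        conjMul (X.transform φ) (X.transform ψ) (√2 * π / X.scale * s) := by
  have hscale := X.scale_pos
  simp only [ambiguity_mul_axis]
  rw [fourier_comp_div _ (by positivity), ← fourier_coe, FourierInvPair.fourier_fourierInv_eq,
    Complex.real_smul]

variable {m : ℝ → ℝ} {M : StateSpace →L[ℂ] StateSpace}

theorem integrable_comp_scale_mul_and_quantForm_eq (hm : Measurable m) (hc : ContinuousAt m 0)
    (h0 : m 0 = 1) (hM : IsOperatorOfWeight (hyperbolicWeight m) M) (f : ℝ → ℂ) (φ ψ : 𝓢(ℝ, ℂ))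
    (hf : Integrable (formIntegrand M (fun z => f (X.coordinate z)) (vec φ) (vec ψ))) :
    Integrable (fun x => f (X.scale * x) * conjMul (X.transform φ) (X.transform ψ) x) ∧
      quantForm M (fun z => f (X.coordinate z)) (vec φ) (vec ψ)
        = ∫ x, f (X.scale * x) * conjMul (X.transform φ) (X.transform ψ) x := by
  have hscale := X.scale_pos
  have hϖ := integrable_weight_mul_ambiguity hM
  rw [integrable_formIntegrand_iff hM] at hf
  simp only [quantForm_vec_eq hM, coordinate_phasePoint, ← schwartzAmbiguity_apply φ ψ] at hf ⊢
  have hslice := integral_comp_inner_mul_fourier_hyperbolicWeight hm hc h0 X.norm_axis X.im_sq_axis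
    (schwartzAmbiguity φ ψ) (by simpa only [schwartzAmbiguity_apply] using hϖ φ ψ)
    (by simpa only [schwartzAmbiguity_apply] using integrable_norm_mul_ambiguity hϖ φ ψ)
    (f := fun s => f (√2 * π * s)) hf
  set r := √2 * π / X.scale with hr
  have hr₀ : 0 < r := by positivity
  have hrescale : (fun s => f (√2 * π * s) *
      𝓕 (fun t : ℝ => schwartzAmbiguity φ ψ (t * X.axis)) s)
      = fun s => (r : ℂ) * (f (X.scale * (r * s)) *
        conjMul (X.transform φ) (X.transform ψ) (r * s)) := by
    funext s
    simp only [schwartzAmbiguity_apply, fourier_ambiguity_mul_axis, ← hr]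
    rw [show X.scale * (r * s) = √2 * π * s by rw [hr]; field_simp]
    ring
  rw [hrescale, integrable_const_mul_iff (by simpa using hr₀.ne')] at hslice
  rw [integral_const_mul] at hslice
  refine ⟨?_, ?_⟩
  · exact (integrable_comp_mul_left_iff (fun x => f (X.scale * x) *
      conjMul (X.transform φ) (X.transform ψ) x) hr₀.ne').1 hslice.1
  · rw [hslice.2, Measure.integral_comp_mul_left (fun x => f (X.scale * x) *
      conjMul (X.transform φ) (X.transform ψ) x), abs_inv, abs_of_pos hr₀, Complex.real_smul]
    push_cast
    rw [mul_inv_cancel_left₀ (by simpa using hr₀.ne')]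

end Quadrature

end Quadratures

section GaussianSummation

theorem continuous_of_isFourierStieltjes {f : ℝ → ℂ} (hf : IsFourierStieltjes f) :
    Continuous f := by
  obtain ⟨μ, g, _, hg, hfg⟩ := hf
  rw [funext hfg]
  refine continuous_of_dominated (bound := fun t => ‖g t‖) (fun x => ?_) (fun x => ?_) hg.norm ?_
  · exact (Continuous.aestronglyMeasurable (by fun_prop)).mul hg.1
  · refine Eventually.of_forall fun t => ?_
    rw [norm_mul, Complex.norm_exp_ofReal_mul_I, one_mul]
  · exact Eventually.of_forall fun t => by fun_prop

theorem exists_norm_le_of_isFourierStieltjes {f : ℝ → ℂ} (hf : IsFourierStieltjes f) :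
    ∃ C, ∀ x, ‖f x‖ ≤ C := by
  obtain ⟨μ, g, _, hg, hfg⟩ := hf
  refine ⟨∫ t, ‖g t‖ ∂μ, fun x => ?_⟩
  rw [hfg]
  refine norm_integral_le_of_norm_le hg.norm (Eventually.of_forall fun t => ?_)
  rw [norm_mul, Complex.norm_exp_ofReal_mul_I, one_mul]

theorem integral_mul_integral_cexp_mul {μ : Measure ℝ} [SFinite μ] {g : ℝ → ℂ}
    (hg : Integrable g μ) {h : ℝ → ℂ} (hh : Integrable h) (k : ℝ) :
    ∫ t, g t * (∫ x, Complex.exp (((t * (k * x) : ℝ) : ℂ) * I) * h x) ∂μ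
      = ∫ x, (∫ t, Complex.exp (((t * (k * x) : ℝ) : ℂ) * I) * g t ∂μ) * h x := by
  have hprod : Integrable (fun p : ℝ × ℝ => Complex.exp (((p.1 * (k * p.2) : ℝ) : ℂ) * I)
      * (g p.1 * h p.2)) (μ.prod volume) := by
    refine (hg.mul_prod hh).bdd_mul (c := 1) (Continuous.aestronglyMeasurable (by fun_prop))
      (Eventually.of_forall fun p => ?_)
    rw [Complex.norm_exp_ofReal_mul_I]
  have hleft (t : ℝ) : g t * (∫ x, Complex.exp (((t * (k * x) : ℝ) : ℂ) * I) * h x)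
      = ∫ x, Complex.exp (((t * (k * x) : ℝ) : ℂ) * I) * (g t * h x) := by
    rw [← integral_const_mul]
    simp only [mul_left_comm (g t)]
  have hright (x : ℝ) : (∫ t, Complex.exp (((t * (k * x) : ℝ) : ℂ) * I) * g t ∂μ) * h x
      = ∫ t, Complex.exp (((t * (k * x) : ℝ) : ℂ) * I) * (g t * h x) ∂μ := by
    rw [← integral_mul_const]
    simp only [mul_assoc]
  simp only [hleft, hright]
  exact integral_integral_swap hprod

theorem integrable_gaussian_mul_comp_phasePoint_mul_fourier {F W : ℂ → ℂ} (hF : Measurable F)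
    {C : ℝ} (hC : ∀ z, ‖F z‖ ≤ C) (hW : Integrable W) {ε : ℝ} (hε : 0 < ε) :
    Integrable fun ξ => (Real.exp (-ε * ‖phasePoint ξ‖ ^ 2) : ℂ) * F (phasePoint ξ) * 𝓕 W ξ := by
  have hgauss : Integrable fun ξ => (Real.exp (-ε * ‖phasePoint ξ‖ ^ 2) : ℂ) :=
    integrable_comp_phasePoint_iff (F := fun z => (Real.exp (-ε * ‖z‖ ^ 2) : ℂ)).2
      (integrable_exp_neg_mul_sq_norm hε).ofReal
  refine (hgauss.mul_bdd (c := C) ?_ (Eventually.of_forall fun ξ => hC _)).mul_bdd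
    (c := ∫ w, ‖W w‖) (continuous_fourierIntegral hW).aestronglyMeasurable
    (Eventually.of_forall fun ξ => norm_fourier_le W ξ)
  exact (hF.comp (by unfold phasePoint; fun_prop)).aestronglyMeasurable

theorem gaussian_mul_formIntegrand (M : StateSpace →L[ℂ] StateSpace) (F : ℂ → ℂ) (ε : ℝ)
    (η ζ : StateSpace) :
    (fun z : ℂ => (Real.exp (-ε * ‖z‖ ^ 2) : ℂ) * formIntegrand M F η ζ z)
      = formIntegrand M (fun z => (Real.exp (-ε * ‖z‖ ^ 2) : ℂ) * F z) η ζ := by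
  funext z
  rw [formIntegrand, formIntegrand, mul_assoc]

theorem norm_phasePoint (ξ : ℂ) : ‖phasePoint ξ‖ = π * ‖ξ‖ := by
  rw [phasePoint_eq_smul, norm_mul, norm_neg, Complex.norm_I, one_mul, norm_smul,
    Real.norm_of_nonneg Real.pi_pos.le]

namespace Quadrature

variable (X : Quadrature) {m : ℝ → ℝ} {M : StateSpace →L[ℂ] StateSpace}

theorem tendsto_integral_gaussian_mul_fourierStieltjes_ambiguity
    (hc : ContinuousAt m 0) (h0 : m 0 = 1) (hM : IsOperatorOfWeight (hyperbolicWeight m) M)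
    {μ : Measure ℝ} [SFinite μ] {g : ℝ → ℂ} (hg : Integrable g μ) (φ ψ : 𝓢(ℝ, ℂ)) :
    Tendsto (fun c : ℝ => ∫ ξ, (Real.exp (-c⁻¹ * ‖ξ‖ ^ 2) : ℂ) *
      ((∫ t, Complex.exp ((2 * π * ⟪((t / √2 : ℝ) : ℂ) * X.axis, ξ⟫_ℝ : ℝ) * I) * g t ∂μ) *
        𝓕 (fun z => hyperbolicWeight m z * ambiguity φ ψ z) ξ)) atTop
      (𝓝 (∫ t, g t * ambiguity φ ψ ((t / √2 : ℝ) * X.axis) ∂μ)) := by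
  have hϖ := integrable_weight_mul_ambiguity hM
  have haxis (t : ℝ) := X.im_sq_ofReal_mul_axis (t / √2)
  have hcont : Continuous (ambiguity φ ψ) :=
    (schwartzAmbiguity φ ψ).continuous.congr (schwartzAmbiguity_apply φ ψ)
  have hV : ∃ C, ∀ z, ‖ambiguity φ ψ z‖ ≤ C := by
    obtain ⟨C, -, hC⟩ := (schwartzAmbiguity φ ψ).decay 0 0
    exact ⟨C, fun z => by simpa [schwartzAmbiguity_apply] using hC z⟩
  obtain ⟨C, hC⟩ := hV
  obtain ⟨K, hK⟩ := exists_norm_integral_heatKernel_hyperbolicWeight_le hc h0 hC (hϖ φ ψ)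
    (integrable_sq_norm_mul_ambiguity hϖ φ ψ)
  have hlim := tendsto_integral_gaussian_mul_fourierStieltjes hg
    (ζ := fun t => ((t / √2 : ℝ) : ℂ) * X.axis) (by fun_prop) (hϖ φ ψ)
    (fun t => (continuousAt_hyperbolicWeight hc (haxis t)).mul
      hcont.continuousAt)
    (fun t c hc => hK _ (haxis t) c hc)
  simpa only [hyperbolicWeight_of_im_sq_eq_zero h0 (haxis _), one_mul] using hlim

theorem quantFormTendsto (hc : ContinuousAt m 0) (h0 : m 0 = 1)
    (hM : IsOperatorOfWeight (hyperbolicWeight m) M) {f : ℝ → ℂ} (hf : IsFourierStieltjes f)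
    (φ ψ : 𝓢(ℝ, ℂ)) :
    QuantFormTendsto M (fun z => f (X.coordinate z)) (vec φ) (vec ψ)
      (∫ x, f (X.scale * x) * conjMul (X.transform φ) (X.transform ψ) x) := by
  have hcont := continuous_of_isFourierStieltjes hf
  obtain ⟨C, hC⟩ := exists_norm_le_of_isFourierStieltjes hf
  obtain ⟨μ, g, _, hg, hfg⟩ := hf
  have hF (ξ : ℂ) : f (X.coordinate (phasePoint ξ)) = ∫ t, Complex.exp
      ((2 * π * ⟪((t / √2 : ℝ) : ℂ) * X.axis, ξ⟫_ℝ : ℝ) * I) * g t ∂μ := by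
    have hsq : √2 ^ 2 = (2 : ℝ) := Real.sq_sqrt zero_le_two
    rw [hfg, coordinate_phasePoint]
    refine integral_congr_ae (Eventually.of_forall fun t => ?_)
    have hphase : t * (√2 * π * ⟪X.axis, ξ⟫_ℝ)
        = 2 * π * ⟪((t / √2 : ℝ) : ℂ) * X.axis, ξ⟫_ℝ := by
      rw [← Complex.real_smul, real_inner_smul_left]
      field_simp
      rw [hsq]
      ring
    simp only [hphase]
  refine ⟨fun ε hε => ?_, ?_⟩
  · rw [gaussian_mul_formIntegrand, integrable_formIntegrand_iff hM]
    exact integrable_gaussian_mul_comp_phasePoint_mul_fourier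
      (hcont.measurable.comp X.measurable_coordinate) (fun z => hC _)
      (integrable_weight_mul_ambiguity hM φ ψ) hε
  · have hlim := X.tendsto_integral_gaussian_mul_fourierStieltjes_ambiguity hc h0 hM hg φ ψ
    simp only [X.ambiguity_axis] at hlim
    rw [integral_mul_integral_cexp_mul hg (conjMul _ _).integrable] at hlim
    simp only [← hfg] at hlim
    have hscale : Tendsto (fun ε : ℝ => (π ^ 2)⁻¹ * ε⁻¹) (𝓝[>] 0) atTop :=
      tendsto_inv_nhdsGT_zero.const_mul_atTop (by positivity)
    refine (hlim.comp hscale).congr fun ε => ?_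
    rw [gaussian_mul_formIntegrand]
    refine Eq.trans ?_ (quantForm_vec_eq hM _ φ ψ).symm
    have hexp (ξ : ℂ) : -((π ^ 2)⁻¹ * ε⁻¹)⁻¹ * ‖ξ‖ ^ 2 = -ε * (π * ‖ξ‖) ^ 2 := by
      rw [mul_inv, inv_inv, inv_inv]
      ring
    simp only [norm_phasePoint, hF, Function.comp_apply, hexp, mul_assoc]

end Quadrature

end GaussianSummation

section MultiplicationOperators

theorem mem_topologicalClosure_of_forall_strongDual {E : Type*} [NormedAddCommGroup E]
    [NormedSpace ℂ E] {S : Submodule ℂ E} {x : E}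
    (h : ∀ L : E →L[ℂ] ℂ, (∀ y ∈ S, L y = 0) → L x = 0) : x ∈ S.topologicalClosure := by
  have : IsClosed (S.topologicalClosure : Set E) := S.isClosed_topologicalClosure
  rw [← Submodule.Quotient.mk_eq_zero]
  refine SeparatingDual.eq_zero_of_forall_dual_eq_zero (R := ℂ) fun L => ?_
  refine h (L ∘L S.topologicalClosure.mkQL) fun y hy => ?_
  have hy₀ : S.topologicalClosure.mkQL y = 0 :=
    (Submodule.Quotient.mk_eq_zero _).2 (S.le_topologicalClosure hy)
  rw [ContinuousLinearMap.comp_apply, hy₀, map_zero]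

theorem mem_topologicalClosure_iff_map {E F : Type*} [NormedAddCommGroup E] [NormedSpace ℂ E]
    [NormedAddCommGroup F] [NormedSpace ℂ F] (e : E ≃L[ℂ] F) (S : Submodule ℂ E) (x : E) :
    x ∈ S.topologicalClosure ↔ e x ∈ (S.map (e : E →ₗ[ℂ] F)).topologicalClosure := by
  rw [← SetLike.mem_coe, ← SetLike.mem_coe, Submodule.topologicalClosure_coe,
    Submodule.topologicalClosure_coe, Submodule.map_coe]
  change _ ↔ e x ∈ closure (e '' S)
  rw [← e.image_closure, e.injective.mem_set_image]

theorem closure_eq_of_topologicalClosure_graph_eq {E F : Type*} [NormedAddCommGroup E]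
    [NormedSpace ℂ E] [NormedAddCommGroup F] [NormedSpace ℂ F] {S T : E →ₗ.[ℂ] F}
    (h : S.graph.topologicalClosure = T.graph) : S.closure = T := by
  have hS : S.IsClosable := ⟨T, h⟩
  exact LinearPMap.eq_of_eq_graph (hS.graph_closure_eq_closure_graph.symm.trans h)

theorem exists_schwartz_eq_one (R : ℝ) :
    ∃ χ : 𝓢(ℝ, ℂ), ∀ x ∈ Metric.closedBall (0 : ℝ) R, χ x = 1 := by
  let b : ContDiffBump (0 : ℝ) := ⟨max R 1, max R 1 + 1, by positivity, by linarith⟩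
  have hsupport : HasCompactSupport fun x => ((b x : ℝ) : ℂ) :=
    b.hasCompactSupport.comp_left (g := fun t : ℝ => (t : ℂ)) Complex.ofReal_zero
  refine ⟨hsupport.toSchwartzMap (Complex.ofRealCLM.contDiff.comp b.contDiff), fun x hx => ?_⟩
  have hb : b x = 1 :=
    b.one_of_mem_closedBall (Metric.closedBall_subset_closedBall (le_max_left R 1) hx)
  change ((b x : ℝ) : ℂ) = 1
  rw [hb, Complex.ofReal_one]

theorem locallyIntegrable_of_integrable_star_mul {h : ℝ → ℂ}
    (H : ∀ φ : 𝓢(ℝ, ℂ), Integrable fun x => star (φ x) * h x) : LocallyIntegrable h := by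
  refine locallyIntegrable_iff.2 fun K hK => ?_
  obtain ⟨R, hR⟩ := hK.isBounded.subset_closedBall 0
  obtain ⟨χ, hχ⟩ := exists_schwartz_eq_one R
  refine (H χ).integrableOn.congr_fun (fun x hx => ?_) hK.measurableSet
  simp only [hχ x (hR hx), star_one, one_mul]

theorem ae_eq_zero_of_integral_star_mul {h : ℝ → ℂ} (hl : LocallyIntegrable h)
    (H : ∀ φ : 𝓢(ℝ, ℂ), ∫ x, star (φ x) * h x = 0) : h =ᵐ[volume] 0 := by
  refine ae_eq_zero_of_integral_contDiff_smul_eq_zero hl fun g hg hc => ?_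
  have hsupport : HasCompactSupport fun x => ((g x : ℝ) : ℂ) :=
    hc.comp_left (g := fun t : ℝ => (t : ℂ)) Complex.ofReal_zero
  rw [← H (hsupport.toSchwartzMap (Complex.ofRealCLM.contDiff.comp hg))]
  refine integral_congr_ae (Eventually.of_forall fun x => ?_)
  change g x • h x = star ((g x : ℝ) : ℂ) * h x
  rw [Complex.star_def, Complex.conj_ofReal, Complex.real_smul]

theorem integrable_star_mul_coeFn (η ζ : StateSpace) :
    Integrable fun x => star (η x) * ζ x := by
  refine (L2.integrable_inner (𝕜 := ℂ) η ζ).congr (Eventually.of_forall fun x => ?_)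
  simp only [RCLike.inner_apply', Complex.star_def]

theorem inner_eq_integral (η ζ : StateSpace) : ⟪η, ζ⟫_ℂ = ∫ x, star (η x) * ζ x := by
  simp only [L2.inner_def, RCLike.inner_apply', Complex.star_def]

theorem integrable_star_mul_vec (φ : 𝓢(ℝ, ℂ)) (η : StateSpace) :
    Integrable fun x => star (φ x) * η x := by
  refine (integrable_star_mul_coeFn (vec φ) η).congr ?_
  filter_upwards [coeFn_vec φ] with x hx
  rw [hx]

theorem ae_eq_of_inner_vec_eq {h : ℝ → ℂ} {η : StateSpace}
    (hint : ∀ φ : 𝓢(ℝ, ℂ), Integrable fun x => star (φ x) * h x)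
    (hinner : ∀ φ : 𝓢(ℝ, ℂ), ⟪vec φ, η⟫_ℂ = ∫ x, star (φ x) * h x) :
    (η : ℝ → ℂ) =ᵐ[volume] h := by
  have hη : LocallyIntegrable (η : ℝ → ℂ) := (Lp.memLp η).locallyIntegrable one_le_two
  have hzero := ae_eq_zero_of_integral_star_mul
    (hη.sub (locallyIntegrable_of_integrable_star_mul hint)) fun φ => by
      simp only [Pi.sub_apply, mul_sub]
      rw [integral_sub (integrable_star_mul_vec φ η) (hint φ), ← hinner, inner_vec_left, sub_self]
  filter_upwards [hzero] with x hx
  exact sub_eq_zero.1 hx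

theorem mem_multiplicationGraph {g : ℝ → ℂ} {x : StateSpace × StateSpace} :
    x ∈ multiplicationGraph g ↔ (x.2 : ℝ → ℂ) =ᵐ[volume] fun t => g t * x.1 t := Iff.rfl

theorem isClosed_multiplicationGraph (g : ℝ → ℂ) :
    IsClosed (multiplicationGraph g : Set (StateSpace × StateSpace)) := by
  refine IsSeqClosed.isClosed fun u x hu hx => ?_
  obtain ⟨ns, hns, hfst⟩ := (tendstoInMeasure_of_tendsto_Lp
    ((continuous_fst.tendsto x).comp hx)).exists_seq_tendsto_ae
  obtain ⟨ms, hms, hsnd⟩ := (tendstoInMeasure_of_tendsto_Lp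
    (((continuous_snd.tendsto x).comp hx).comp hns.tendsto_atTop)).exists_seq_tendsto_ae
  have hmul : ∀ᵐ t, ∀ n, (u n).2 t = g t * (u n).1 t := ae_all_iff.2 fun n => hu n
  refine mem_multiplicationGraph.2 ?_
  filter_upwards [hfst, hsnd, hmul] with t ht₁ ht₂ ht
  refine tendsto_nhds_unique ht₂ ?_
  simp only [Function.comp_apply, ht]
  exact (ht₁.comp hms.tendsto_atTop).const_mul _

theorem exists_forall_mem_multiplicationGraph_eq_integral (g : ℝ → ℂ)
    (L : StateSpace × StateSpace →L[ℂ] ℂ) :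
    ∃ a b : StateSpace, ∀ y ∈ multiplicationGraph g,
      L y = ∫ t, y.1 t * (star (a t) + star (b t) * g t) := by
  refine ⟨(InnerProductSpace.toDual ℂ StateSpace).symm (L ∘L .inl ℂ StateSpace StateSpace),
    (InnerProductSpace.toDual ℂ StateSpace).symm (L ∘L .inr ℂ StateSpace StateSpace),
    fun y hy => ?_⟩
  set a := (InnerProductSpace.toDual ℂ StateSpace).symm (L ∘L .inl ℂ StateSpace StateSpace) with ha
  set b := (InnerProductSpace.toDual ℂ StateSpace).symm (L ∘L .inr ℂ StateSpace StateSpace) with hb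
  have hsplit : L y = ⟪a, y.1⟫_ℂ + ⟪b, y.2⟫_ℂ := by
    rw [ha, hb, InnerProductSpace.toDual_symm_apply, InnerProductSpace.toDual_symm_apply,
      ContinuousLinearMap.comp_apply, ContinuousLinearMap.comp_apply, ← map_add,
      ContinuousLinearMap.inl_apply, ContinuousLinearMap.inr_apply, Prod.fst_add_snd]
  rw [hsplit, inner_eq_integral, inner_eq_integral,
    ← integral_add (integrable_star_mul_coeFn _ _) (integrable_star_mul_coeFn _ _)]
  refine integral_congr_ae ?_
  filter_upwards [mem_multiplicationGraph.1 hy] with t ht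
  rw [ht]
  ring

theorem locallyIntegrable_star_mul_of_forall_vec_mem {g : ℝ → ℂ}
    (hg : ∀ φ : 𝓢(ℝ, ℂ), ∃ η, (vec φ, η) ∈ multiplicationGraph g) (b : StateSpace) :
    LocallyIntegrable fun t => star (b t) * g t := by
  refine locallyIntegrable_of_integrable_star_mul fun φ => ?_
  obtain ⟨η, hη⟩ := hg (schwartzConj φ)
  refine (integrable_star_mul_coeFn b η).congr ?_
  filter_upwards [mem_multiplicationGraph.1 hη, coeFn_vec (schwartzConj φ)] with t ht hφ
  rw [ht, hφ, schwartzConj_apply]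
  ring

/- A functional on pairs restricts to the graph of multiplication by `g` as integration of the
first component against a locally integrable function. If it vanishes at the pairs with a Schwartz
first component, then this function is `0`. -/
theorem topologicalClosure_eq_multiplicationGraph {g : ℝ → ℂ}
    {G : Submodule ℂ (StateSpace × StateSpace)} (hle : G ≤ multiplicationGraph g)
    (hG : ∀ φ : 𝓢(ℝ, ℂ), ∃ η, (vec φ, η) ∈ G) :
    G.topologicalClosure = multiplicationGraph g := by
  refine le_antisymm (G.topologicalClosure_minimal hle (isClosed_multiplicationGraph g))
    fun x hx => mem_topologicalClosure_of_forall_strongDual fun L hL => ?_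
  obtain ⟨a, b, hab⟩ := exists_forall_mem_multiplicationGraph_eq_integral g L
  have hloc : LocallyIntegrable fun t => star (a t) + star (b t) * g t :=
    ((Lp.memLp a).star.locallyIntegrable one_le_two).add
      (locallyIntegrable_star_mul_of_forall_vec_mem (fun φ => (hG φ).imp fun _ h => hle h) b)
  have hzero := ae_eq_zero_of_integral_star_mul hloc fun φ => by
    obtain ⟨η, hη⟩ := hG (schwartzConj φ)
    rw [← hL _ hη, hab _ (hle hη)]
    refine integral_congr_ae ?_
    filter_upwards [coeFn_vec (schwartzConj φ)] with t ht
    rw [ht, schwartzConj_apply]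
  rw [hab x hx]
  refine integral_eq_zero_of_ae ?_
  filter_upwards [hzero] with t ht
  simp only [ht, Pi.zero_apply, mul_zero]

end MultiplicationOperators

section Closure

namespace Quadrature

variable (X : Quadrature)

theorem graph_functionOf (f : ℝ → ℂ) :
    (X.functionOf f).graph = (multiplicationGraph fun x => f (X.scale * x)).comap
      (X.unitary.toLinearEquiv.toLinearMap.prodMap X.unitary.toLinearEquiv.toLinearMap) := by
  refine Submodule.toLinearPMap_graph_eq _ fun x hx h₀ => ?_
  refine X.unitary.map_eq_zero_iff.1 (multiplicationGraph_functional _ _ hx ?_)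
  exact X.unitary.map_eq_zero_iff.2 h₀

theorem mem_graph_functionOf {f : ℝ → ℂ} {ψ η : StateSpace} :
    (ψ, η) ∈ (X.functionOf f).graph ↔
      (X.unitary η : ℝ → ℂ) =ᵐ[volume] fun x => f (X.scale * x) * X.unitary ψ x := by
  rw [graph_functionOf]
  rfl

theorem closure_eq_functionOf {S : StateSpace →ₗ.[ℂ] StateSpace} {f : ℝ → ℂ}
    (hle : S ≤ X.functionOf f) (hS : S.domain = schwartzDomain) : S.closure = X.functionOf f := by
  let e : (StateSpace × StateSpace) ≃L[ℂ] (StateSpace × StateSpace) :=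
    X.unitary.toContinuousLinearEquiv.prodCongr X.unitary.toContinuousLinearEquiv
  have hgraph : S.graph.map (e : (StateSpace × StateSpace) →ₗ[ℂ] StateSpace × StateSpace)
      ≤ multiplicationGraph fun x => f (X.scale * x) := by
    rintro _ ⟨y, hy, rfl⟩
    exact X.mem_graph_functionOf.1 (LinearPMap.le_graph_of_le hle hy)
  refine closure_eq_of_topologicalClosure_graph_eq ?_
  ext x : 1
  rw [mem_topologicalClosure_iff_map e,
    topologicalClosure_eq_multiplicationGraph hgraph fun φ => ?_, graph_functionOf]
  · rfl
  · obtain ⟨η, hη⟩ := LinearPMap.mem_domain_iff.1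
      (show vec (X.transform.symm φ) ∈ S.domain from hS ▸ vec_mem_schwartzDomain _)
    refine ⟨X.unitary η, _, hη, ?_⟩
    change (X.unitary (vec _), X.unitary η) = _
    rw [X.unitary_vec, ContinuousLinearEquiv.apply_symm_apply]

theorem inner_vec_symm_transform (φ : 𝓢(ℝ, ℂ)) (η : StateSpace) :
    ⟪vec (X.transform.symm φ), η⟫_ℂ = ⟪vec φ, X.unitary η⟫_ℂ := by
  rw [← X.unitary.inner_map_map, X.unitary_vec, ContinuousLinearEquiv.apply_symm_apply]

variable {m : ℝ → ℝ} {M : StateSpace →L[ℂ] StateSpace}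

theorem quantize_le_functionOf (hm : Measurable m) (hc : ContinuousAt m 0) (h0 : m 0 = 1)
    (hM : IsOperatorOfWeight (hyperbolicWeight m) M) (f : ℝ → ℂ) :
    (quantize M fun z => f (X.coordinate z)) ≤ X.functionOf f := by
  refine LinearPMap.le_of_le_graph ?_
  rw [graph_quantize]
  rintro ⟨_, η⟩ ⟨⟨ψ, rfl⟩, hη⟩
  have hform (φ : 𝓢(ℝ, ℂ)) := X.integrable_comp_scale_mul_and_quantForm_eq hm hc h0 hM f
    (X.transform.symm φ) ψ (hη _ (vec_mem_schwartzDomain _)).1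
  simp only [ContinuousLinearEquiv.apply_symm_apply, conjMul_apply, mul_left_comm (f _)] at hform
  have hη' : (X.unitary η : ℝ → ℂ) =ᵐ[volume] fun x => f (X.scale * x) * X.transform ψ x := by
    refine ae_eq_of_inner_vec_eq (fun φ => (hform φ).1) fun φ => ?_
    rw [← inner_vec_symm_transform, ← (hform φ).2]
    exact (hη _ (vec_mem_schwartzDomain _)).2.symm
  refine X.mem_graph_functionOf.2 ?_
  filter_upwards [hη', coeFn_vec (X.transform ψ)] with x hx hψ
  rw [hx, ← hψ, ← X.unitary_vec]
  rfl

end Quadrature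

end Closure

section TemperedWeights

theorem memLp_mul_schwartz {E : Type*} [NormedAddCommGroup E] [InnerProductSpace ℝ E]
    [MeasurableSpace E] [BorelSpace E] [SecondCountableTopology E] {μ : Measure E}
    [μ.HasTemperateGrowth] {F : E → ℂ} (hF : AEStronglyMeasurable F μ) {C : ℝ} {k : ℕ}
    (hC : ∀ x, ‖F x‖ ≤ C * (1 + ‖x‖) ^ k) (Ψ : 𝓢(E, ℂ)) (p : ENNReal) :
    MemLp (fun x => F x * Ψ x) p μ := by
  have ht : (fun x : E => (1 + ‖x‖ ^ 2) ^ k).HasTemperateGrowth :=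
    ((Function.HasTemperateGrowth.const (1 : ℝ)).add (Function.hasTemperateGrowth_norm_sq E)).pow k
  have hC₀ : 0 ≤ C := by simpa using (norm_nonneg _).trans (hC 0)
  refine MemLp.of_le_mul (c := C * 2 ^ k)
    ((smulLeftCLM ℂ (fun x : E => (1 + ‖x‖ ^ 2) ^ k) Ψ).memLp p μ)
    (hF.mul Ψ.continuous.aestronglyMeasurable) (Eventually.of_forall fun x => ?_)
  rw [smulLeftCLM_apply_apply ht, norm_smul, norm_mul, Real.norm_of_nonneg (by positivity),
    ← mul_assoc, mul_assoc C, ← mul_pow]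
  have hx : 1 + ‖x‖ ≤ 2 * (1 + ‖x‖ ^ 2) := by nlinarith [sq_nonneg (‖x‖ - 1), sq_nonneg ‖x‖]
  exact mul_le_mul_of_nonneg_right ((hC x).trans (by gcongr)) (norm_nonneg _)

theorem exists_norm_comp_le_mul_pow {D E G : Type*} [NormedAddCommGroup D]
    [NormedAddCommGroup E] [NormedAddCommGroup G] {F : D → G} {C : ℝ} {k : ℕ}
    (hF : ∀ x, ‖F x‖ ≤ C * (1 + ‖x‖) ^ k) {u : E → D} {c : ℝ} (hu : ∀ x, ‖u x‖ ≤ c * ‖x‖) :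
    ∃ C' : ℝ, ∀ x, ‖F (u x)‖ ≤ C' * (1 + ‖x‖) ^ k := by
  have hC₀ : 0 ≤ C := by simpa using (norm_nonneg _).trans (hF 0)
  refine ⟨C * (1 + |c|) ^ k, fun x => (hF _).trans ?_⟩
  rw [mul_assoc, ← mul_pow]
  have hx : 1 + ‖u x‖ ≤ (1 + |c|) * (1 + ‖x‖) := by
    nlinarith [hu x, norm_nonneg x, le_abs_self c, abs_nonneg c]
  gcongr

theorem hasTemperateGrowth_hyperbolicWeight {m : ℝ → ℝ} (hm : m.HasTemperateGrowth) :
    (hyperbolicWeight m).HasTemperateGrowth :=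
  Function.Complex.hasTemperateGrowth_ofReal.comp
    (hm.comp (Complex.imCLM.hasTemperateGrowth.comp (Function.HasTemperateGrowth.id.pow 2)))

theorem exists_schwartz_eq_weight_mul_ambiguity {ϖ : ℂ → ℂ} (hϖ : ϖ.HasTemperateGrowth)
    (φ ψ : 𝓢(ℝ, ℂ)) : ∃ W : 𝓢(ℂ, ℂ), ∀ z, W z = ϖ z * ambiguity φ ψ z :=
  ⟨smulLeftCLM ℂ ϖ (schwartzAmbiguity φ ψ), fun z => by
    rw [smulLeftCLM_apply_apply hϖ, schwartzAmbiguity_apply, smul_eq_mul]⟩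

variable {M : StateSpace →L[ℂ] StateSpace}

theorem vec_mem_graph_quantize {F : ℂ → ℂ} {ψ : 𝓢(ℝ, ℂ)} {η : StateSpace}
    (h : ∀ φ : 𝓢(ℝ, ℂ), Integrable (formIntegrand M F (vec φ) (vec ψ)) ∧
      quantForm M F (vec φ) (vec ψ) = ⟪vec φ, η⟫_ℂ) :
    (vec ψ, η) ∈ (quantize M F).graph := by
  rw [graph_quantize]
  refine ⟨vec_mem_schwartzDomain ψ, ?_⟩
  rintro _ ⟨φ, rfl⟩
  exact h φ

theorem domain_quantize_eq {F : ℂ → ℂ}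
    (h : ∀ ψ : 𝓢(ℝ, ℂ), ∃ η, (vec ψ, η) ∈ (quantize M F).graph) :
    (quantize M F).domain = schwartzDomain := by
  refine le_antisymm (fun ψ hψ => ?_) ?_
  · obtain ⟨η, hη⟩ := LinearPMap.mem_domain_iff.1 hψ
    rw [graph_quantize] at hη
    exact hη.1
  · rintro _ ⟨ψ, rfl⟩
    exact LinearPMap.mem_domain_iff.2 (h ψ)

theorem integrable_formIntegrand {ϖ : ℂ → ℂ} (hϖ : ϖ.HasTemperateGrowth)
    (hM : IsOperatorOfWeight ϖ M) {F : ℂ → ℂ} (hF : Measurable F) {C : ℝ} {k : ℕ}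
    (hC : ∀ w, ‖F w‖ ≤ C * (1 + ‖w‖) ^ k) (φ ψ : 𝓢(ℝ, ℂ)) :
    Integrable (formIntegrand M F (vec φ) (vec ψ)) := by
  obtain ⟨W, hW⟩ := exists_schwartz_eq_weight_mul_ambiguity hϖ φ ψ
  obtain ⟨C', hC'⟩ := exists_norm_comp_le_mul_pow hC fun ξ => (norm_phasePoint ξ).le
  have hmeas : Measurable phasePoint := by
    unfold phasePoint
    fun_prop
  rw [integrable_formIntegrand_iff hM]
  simp only [← hW, ← fourier_coe]
  exact memLp_one_iff_integrable.1
    (memLp_mul_schwartz (hF.comp hmeas).aestronglyMeasurable hC' (𝓕 W) 1)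

variable {m : ℝ → ℝ}

theorem Quadrature.domain_quantize (X : Quadrature) (hm : m.HasTemperateGrowth) (h0 : m 0 = 1)
    (hM : IsOperatorOfWeight (hyperbolicWeight m) M) {f : ℝ → ℂ} (hf : IsSlowlyIncreasing f) :
    (quantize M fun z => f (X.coordinate z)).domain = schwartzDomain := by
  have hcont : Continuous m := hm.1.continuous
  obtain ⟨hmeas, C, k, hC⟩ := hf
  obtain ⟨C₁, hC₁⟩ := exists_norm_comp_le_mul_pow hC X.abs_coordinate_le
  obtain ⟨C₂, hC₂⟩ := exists_norm_comp_le_mul_pow hC fun x => (norm_mul X.scale x).le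
  refine domain_quantize_eq fun ψ => ?_
  have hL : MemLp (fun x => f (X.scale * x) * X.transform ψ x) 2 volume :=
    memLp_mul_schwartz (hmeas.comp (measurable_const_mul X.scale)).aestronglyMeasurable hC₂ _ 2
  refine ⟨X.unitary.symm (hL.toLp _), vec_mem_graph_quantize fun φ => ?_⟩
  have hint := integrable_formIntegrand (hasTemperateGrowth_hyperbolicWeight hm) hM
    (hmeas.comp X.measurable_coordinate) hC₁ φ ψ
  refine ⟨hint, ?_⟩
  rw [← X.unitary.inner_map_map, X.unitary_vec, LinearIsometryEquiv.apply_symm_apply,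
    inner_vec_eq_integral _ hL.coeFn_toLp]
  refine (X.integrable_comp_scale_mul_and_quantForm_eq hcont.measurable hcont.continuousAt h0 hM
    f φ ψ hint).2.trans (integral_congr_ae (Eventually.of_forall fun x => ?_))
  exact mul_left_comm _ _ _

end TemperedWeights

section PositionAndMomentum

variable {m : ℝ → ℝ} {M : StateSpace →L[ℂ] StateSpace}

theorem mul_conjMul_apply (c : ℂ) (φ ψ : 𝓢(ℝ, ℂ)) (x : ℝ) :
    c * conjMul φ ψ x = star (φ x) * c * ψ x := by
  rw [conjMul_apply, mul_left_comm, mul_assoc]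

theorem integrable_and_quantForm_position_eq (hm : Measurable m) (hc : ContinuousAt m 0)
    (h0 : m 0 = 1) (hM : IsOperatorOfWeight (hyperbolicWeight m) M) (f : ℝ → ℂ) (φ ψ : 𝓢(ℝ, ℂ))
    (hf : Integrable (formIntegrand M (fun z => f (position z)) (vec φ) (vec ψ))) :
    Integrable (fun x : ℝ => star (φ x) * f x * ψ x) ∧
      quantForm M (fun z => f (position z)) (vec φ) (vec ψ)
        = ∫ x : ℝ, star (φ x) * f x * ψ x := by
  rw [← coordinate_positionQuadrature] at hf ⊢
  have h := positionQuadrature.integrable_comp_scale_mul_and_quantForm_eq hm hc h0 hM f φ ψ hf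
  simp only [mul_conjMul_apply, show positionQuadrature.scale = 1 from rfl, one_mul] at h
  exact h

theorem integrable_and_quantForm_momentum_eq (hm : Measurable m) (hc : ContinuousAt m 0)
    (h0 : m 0 = 1) (hM : IsOperatorOfWeight (hyperbolicWeight m) M) (f : ℝ → ℂ) (φ ψ : 𝓢(ℝ, ℂ))
    (hf : Integrable (formIntegrand M (fun z => f (momentum z)) (vec φ) (vec ψ))) :
    Integrable (fun ξ : ℝ => star (𝓕 φ ξ) * f (2 * π * ξ) * 𝓕 ψ ξ) ∧
      quantForm M (fun z => f (momentum z)) (vec φ) (vec ψ)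
        = ∫ ξ : ℝ, star (𝓕 φ ξ) * f (2 * π * ξ) * 𝓕 ψ ξ := by
  rw [← coordinate_momentumQuadrature] at hf ⊢
  have h := momentumQuadrature.integrable_comp_scale_mul_and_quantForm_eq hm hc h0 hM f φ ψ hf
  simp only [mul_conjMul_apply] at h
  exact h

theorem quantFormTendsto_position (hc : ContinuousAt m 0) (h0 : m 0 = 1)
    (hM : IsOperatorOfWeight (hyperbolicWeight m) M) {f : ℝ → ℂ} (hf : IsFourierStieltjes f)
    (φ ψ : 𝓢(ℝ, ℂ)) :
    QuantFormTendsto M (fun z => f (position z)) (vec φ) (vec ψ)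
      (∫ x : ℝ, star (φ x) * f x * ψ x) := by
  have h := positionQuadrature.quantFormTendsto hc h0 hM hf φ ψ
  simp only [mul_conjMul_apply, coordinate_positionQuadrature,
    show positionQuadrature.scale = 1 from rfl, one_mul] at h
  exact h

theorem quantFormTendsto_momentum (hc : ContinuousAt m 0) (h0 : m 0 = 1)
    (hM : IsOperatorOfWeight (hyperbolicWeight m) M) {f : ℝ → ℂ} (hf : IsFourierStieltjes f)
    (φ ψ : 𝓢(ℝ, ℂ)) :
    QuantFormTendsto M (fun z => f (momentum z)) (vec φ) (vec ψ)
      (∫ ξ : ℝ, star (𝓕 φ ξ) * f (2 * π * ξ) * 𝓕 ψ ξ) := by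
  have h := momentumQuadrature.quantFormTendsto hc h0 hM hf φ ψ
  simp only [mul_conjMul_apply, coordinate_momentumQuadrature] at h
  exact h

theorem quantize_position_le_functionOfQ (hm : Measurable m) (hc : ContinuousAt m 0)
    (h0 : m 0 = 1) (hM : IsOperatorOfWeight (hyperbolicWeight m) M) (f : ℝ → ℂ) :
    (quantize M fun z => f (position z)) ≤ functionOfQ f := by
  rw [← coordinate_positionQuadrature, ← functionOf_positionQuadrature]
  exact positionQuadrature.quantize_le_functionOf hm hc h0 hM f

theorem quantize_momentum_le_functionOfP (hm : Measurable m) (hc : ContinuousAt m 0)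
    (h0 : m 0 = 1) (hM : IsOperatorOfWeight (hyperbolicWeight m) M) (f : ℝ → ℂ) :
    (quantize M fun z => f (momentum z)) ≤ functionOfP f := by
  rw [← coordinate_momentumQuadrature, ← functionOf_momentumQuadrature]
  exact momentumQuadrature.quantize_le_functionOf hm hc h0 hM f

theorem closure_eq_functionOfQ {S : StateSpace →ₗ.[ℂ] StateSpace} {f : ℝ → ℂ}
    (hle : S ≤ functionOfQ f) (hS : S.domain = schwartzDomain) : S.closure = functionOfQ f := by
  rw [← functionOf_positionQuadrature] at hle ⊢
  exact positionQuadrature.closure_eq_functionOf hle hS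

theorem closure_eq_functionOfP {S : StateSpace →ₗ.[ℂ] StateSpace} {f : ℝ → ℂ}
    (hle : S ≤ functionOfP f) (hS : S.domain = schwartzDomain) : S.closure = functionOfP f := by
  rw [← functionOf_momentumQuadrature] at hle ⊢
  exact momentumQuadrature.closure_eq_functionOf hle hS

theorem isCanonicalOnQAndP (hm : m.HasTemperateGrowth) (h0 : m 0 = 1)
    (hM : IsOperatorOfWeight (hyperbolicWeight m) M) : IsCanonicalOnQAndP M := by
  intro f hf
  have hcont : Continuous m := hm.1.continuous
  have hq := positionQuadrature.domain_quantize hm h0 hM hf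
  have hp := momentumQuadrature.domain_quantize hm h0 hM hf
  rw [coordinate_positionQuadrature] at hq
  rw [coordinate_momentumQuadrature] at hp
  exact ⟨⟨hq, closure_eq_functionOfQ (quantize_position_le_functionOfQ hcont.measurable
      hcont.continuousAt h0 hM f) hq⟩,
    hp, closure_eq_functionOfP (quantize_momentum_le_functionOfP hcont.measurable
      hcont.continuousAt h0 hM f) hp⟩

end PositionAndMomentum

section ExponentialWeights

theorem ambiguity_eq_fourierInv (φ ψ : 𝓢(ℝ, ℂ)) (a b : ℝ) :
    ambiguity φ ψ ⟨a, b⟩ = 𝓕⁻ (conjMul (compSubConstCLM ℂ (-(a / √2)) φ)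
      (compSubConstCLM ℂ (a / √2) ψ)) (b / (√2 * π)) := by
  rw [fourierInv_coe, Real.fourierInv_eq', ambiguity, ← integral_add_right_eq_self _ (a / √2)]
  refine integral_congr_ae (Eventually.of_forall fun u => ?_)
  have hsq : √2 ^ 2 = (2 : ℝ) := Real.sq_sqrt zero_le_two
  have hq : √2 * a = a / √2 + a / √2 := by
    field_simp
    linear_combination a * hsq
  have hphase : √2 * b * (u + a / √2 - (a / √2 + a / √2) / 2)
      = 2 * π * ⟪u, b / (√2 * π)⟫_ℝ := by
    simp only [RCLike.inner_apply, conj_trivial]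
    field_simp
    linear_combination 2 * b * u * hsq
  simp only [displacementFun, conjMul_apply, compSubConstCLM_apply, smul_eq_mul, position,
    momentum, hq, hphase]
  rw [mul_left_comm, add_sub_add_right_eq_sub, sub_neg_eq_add]

theorem fourier_ambiguity_im (φ ψ : 𝓢(ℝ, ℂ)) (a s : ℝ) :
    𝓕 (fun b : ℝ => ambiguity φ ψ ⟨a, b⟩) s = (√2 * π : ℝ) *
      (star (φ (√2 * π * s + a / √2)) * ψ (√2 * π * s - a / √2)) := by
  simp only [ambiguity_eq_fourierInv]
  rw [fourier_comp_div _ (by positivity), ← fourier_coe, FourierInvPair.fourier_fourierInv_eq,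
    Complex.real_smul, conjMul_apply, compSubConstCLM_apply, compSubConstCLM_apply, sub_neg_eq_add]

/-- The weight `z ↦ exp (i l Im z²)`, that is `m(Im z²)` with `m(s) = exp (i l s)`; its operator is
a multiple of a dilation composed with the parity. -/
def expWeight (l : ℝ) (z : ℂ) : ℂ := Complex.exp (((l * (z ^ 2).im : ℝ) : ℂ) * I)

theorem integrable_expWeight_mul_ambiguity (l : ℝ) (φ ψ : 𝓢(ℝ, ℂ)) :
    Integrable fun z => expWeight l z * ambiguity φ ψ z := by
  simp only [← schwartzAmbiguity_apply φ ψ]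
  refine (schwartzAmbiguity φ ψ).integrable.bdd_mul (c := 1)
    (Continuous.aestronglyMeasurable ?_) (Eventually.of_forall fun z => ?_)
  · unfold expWeight
    fun_prop
  · rw [expWeight, Complex.norm_exp_ofReal_mul_I]

theorem im_sq_mk (a b : ℝ) : ((⟨a, b⟩ : ℂ) ^ 2).im = 2 * a * b := by
  rw [sq, Complex.mul_im]
  ring

/- For fixed `a = Re z` the weight `exp (2 i l a b)` is a character of `b = Im z`, hence the inner
integral is a Fourier transform. -/
theorem integral_expWeight_mul_ambiguity_im (l : ℝ) (φ ψ : 𝓢(ℝ, ℂ)) (a : ℝ) :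
    ∫ b : ℝ, expWeight l ⟨a, b⟩ * ambiguity φ ψ ⟨a, b⟩ = (√2 * π : ℝ) *
      (star (φ ((1 / 2 - l) * (√2 * a))) * ψ (-(1 / 2 + l) * (√2 * a))) := by
  have hsq : √2 ^ 2 = (2 : ℝ) := Real.sq_sqrt zero_le_two
  have hplus : (1 / 2 - l) * (√2 * a) = √2 * π * -(l * a / π) + a / √2 := by
    field_simp
    linear_combination a * hsq
  have hminus : -(1 / 2 + l) * (√2 * a) = √2 * π * -(l * a / π) - a / √2 := by
    field_simp
    linear_combination (-a) * hsq
  rw [hplus, hminus, ← fourier_ambiguity_im, Real.fourier_eq']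
  refine integral_congr_ae (Eventually.of_forall fun b => ?_)
  have hphase : l * (2 * a * b) = -2 * π * ⟪b, -(l * a / π)⟫_ℝ := by
    simp only [RCLike.inner_apply, conj_trivial]
    field_simp
  simp only [smul_eq_mul, expWeight, im_sq_mk, hphase]

theorem integral_expWeight_mul_ambiguity (l : ℝ) (φ ψ : 𝓢(ℝ, ℂ)) :
    (π : ℂ)⁻¹ * ∫ z, expWeight l z * ambiguity φ ψ z
      = ∫ x : ℝ, star (φ ((1 / 2 - l) * x)) * ψ (-(1 / 2 + l) * x) := by
  rw [integral_complex_eq, integral_prod _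
    (integrable_complex_iff.1 (integrable_expWeight_mul_ambiguity l φ ψ))]
  simp only [integral_expWeight_mul_ambiguity_im]
  rw [integral_const_mul, Measure.integral_comp_mul_left (fun x : ℝ =>
    star (φ ((1 / 2 - l) * x)) * ψ (-(1 / 2 + l) * x)) √2, abs_of_pos (by positivity),
    Complex.real_smul, ← mul_assoc, ← mul_assoc]
  have hcancel : (π : ℂ)⁻¹ * (√2 * π : ℝ) * ((√2)⁻¹ : ℝ) = 1 := by
    norm_cast
    field_simp
  rw [hcancel, one_mul]

theorem isOperatorOfWeight_expWeight {l : ℝ} (hl : l ≠ 1 / 2) {M : StateSpace →L[ℂ] StateSpace}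
    (hM : ∀ ψ : 𝓢(ℝ, ℂ), (M (vec ψ) : ℝ → ℂ) =ᵐ[volume]
      fun x => (|1 / 2 - l|⁻¹ : ℝ) * ψ (-(1 / 2 + l) / (1 / 2 - l) * x)) :
    IsOperatorOfWeight (expWeight l) M := by
  intro φ ψ
  have hne : 1 / 2 - l ≠ 0 := sub_ne_zero.2 hl.symm
  simp only [inner_displacement_vec]
  refine ⟨integrable_expWeight_mul_ambiguity l φ ψ, ?_⟩
  have hscale : (fun x => star (φ ((1 / 2 - l) * x)) * ψ (-(1 / 2 + l) * x)) = fun x =>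
      (fun y => star (φ y) * ψ (-(1 / 2 + l) / (1 / 2 - l) * y)) ((1 / 2 - l) * x) := by
    funext x
    simp only [← mul_assoc, div_mul_cancel₀ _ hne]
  rw [integral_expWeight_mul_ambiguity, hscale, Measure.integral_comp_mul_left
    (fun y => star (φ y) * ψ (-(1 / 2 + l) / (1 / 2 - l) * y)), abs_inv, Complex.real_smul,
    inner_vec_eq_integral φ (hM ψ), ← integral_const_mul]
  exact integral_congr_ae (Eventually.of_forall fun x => mul_left_comm _ _ _)

theorem expWeight_zero : expWeight 0 = hyperbolicWeight fun _ => 1 := by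
  funext z
  simp [expWeight, hyperbolicWeight]

theorem isOperatorOfWeight_weylWigner :
    IsOperatorOfWeight (hyperbolicWeight fun _ => 1) weylWigner := by
  rw [← expWeight_zero]
  refine isOperatorOfWeight_expWeight (by norm_num) fun ψ => ?_
  have hneg := Measure.measurePreserving_neg (volume : Measure ℝ)
  filter_upwards [Lp.coeFn_smul (2 : ℂ) (parity (vec ψ)),
    Lp.coeFn_compMeasurePreserving (vec ψ) hneg,
    hneg.quasiMeasurePreserving.ae_eq_comp (coeFn_vec ψ)] with x hsmul hparity hψ
  refine (hsmul.trans (congrArg ((2 : ℂ) * ·) (hparity.trans hψ))).trans ?_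
  norm_num [abs_of_pos]

end ExponentialWeights

section Dilations

theorem quasiMeasurePreserving_mul_left {r : ℝ} (hr : r ≠ 0) :
    Measure.QuasiMeasurePreserving (r * ·) volume volume :=
  ⟨measurable_const_mul r, by
    rw [Real.map_volume_mul_left hr]
    exact Measure.smul_absolutelyContinuous⟩

theorem ae_eq_comp_mul_left {r : ℝ} (hr : r ≠ 0) {φ ψ : ℝ → ℂ} (h : φ =ᵐ[volume] ψ) :
    (fun x => φ (r * x)) =ᵐ[volume] fun x => ψ (r * x) :=
  (quasiMeasurePreserving_mul_left hr).ae_eq_comp h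

theorem eLpNorm_comp_mul_left {r : ℝ} (hr : r ≠ 0) {φ : ℝ → ℂ}
    (hφ : AEStronglyMeasurable φ volume) :
    eLpNorm (fun x => φ (r * x)) 2 volume
      = ENNReal.ofReal |r⁻¹| ^ (1 / 2 : ℝ) * eLpNorm φ 2 volume := by
  have hmap := Real.map_volume_mul_left hr
  have hφ' : AEStronglyMeasurable φ (Measure.map (r * ·) volume) := by
    rw [hmap]
    exact hφ.smul_measure _
  have h := eLpNorm_map_measure (p := 2) hφ' (measurable_const_mul r).aemeasurable
  rw [hmap, eLpNorm_smul_measure_of_ne_top (by simp)] at h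
  simpa [Function.comp_def] using h.symm

theorem memLp_comp_mul_left {r : ℝ} (hr : r ≠ 0) {φ : ℝ → ℂ} (hφ : MemLp φ 2 volume) :
    MemLp (fun x => φ (r * x)) 2 volume := by
  refine ⟨hφ.1.comp_quasiMeasurePreserving (quasiMeasurePreserving_mul_left hr), ?_⟩
  rw [eLpNorm_comp_mul_left hr hφ.1]
  exact ENNReal.mul_lt_top (ENNReal.rpow_lt_top_of_nonneg (by norm_num) ENNReal.ofReal_ne_top) hφ.2

/-- The dilation `ψ ↦ ψ(r x)` of `L²(ℝ)`, not normalized to be unitary. -/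
def dilation {r : ℝ} (hr : r ≠ 0) : StateSpace →L[ℂ] StateSpace :=
  LinearMap.mkContinuous
    { toFun := fun φ => (memLp_comp_mul_left hr (Lp.memLp φ)).toLp fun x => φ (r * x)
      map_add' := fun φ ψ => by
        rw [← MemLp.toLp_add]
        exact MemLp.toLp_congr _ _ (ae_eq_comp_mul_left hr (Lp.coeFn_add φ ψ))
      map_smul' := fun c φ => by
        rw [RingHom.id_apply, ← MemLp.toLp_const_smul]
        exact MemLp.toLp_congr _ _ (ae_eq_comp_mul_left hr (Lp.coeFn_smul c φ)) }
    (ENNReal.ofReal |r⁻¹| ^ (1 / 2 : ℝ)).toReal fun φ => by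
      change ‖(memLp_comp_mul_left hr (Lp.memLp φ)).toLp fun x => φ (r * x)‖ ≤ _
      rw [Lp.norm_toLp, eLpNorm_comp_mul_left hr (Lp.memLp φ).1, ENNReal.toReal_mul, Lp.norm_def]

theorem coeFn_dilation_vec {r : ℝ} (hr : r ≠ 0) (ψ : 𝓢(ℝ, ℂ)) :
    (dilation hr (vec ψ) : ℝ → ℂ) =ᵐ[volume] fun x => ψ (r * x) :=
  (MemLp.coeFn_toLp (memLp_comp_mul_left hr (Lp.memLp (vec ψ)))).trans
    (ae_eq_comp_mul_left hr (coeFn_vec ψ))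

theorem IsOperatorOfWeight.add {ϖ₁ ϖ₂ : ℂ → ℂ} {M₁ M₂ : StateSpace →L[ℂ] StateSpace}
    (h₁ : IsOperatorOfWeight ϖ₁ M₁) (h₂ : IsOperatorOfWeight ϖ₂ M₂) :
    IsOperatorOfWeight (ϖ₁ + ϖ₂) (M₁ + M₂) := by
  intro φ ψ
  simp only [Pi.add_apply, add_mul]
  refine ⟨(h₁ φ ψ).1.add (h₂ φ ψ).1, ?_⟩
  rw [integral_add (h₁ φ ψ).1 (h₂ φ ψ).1, mul_add, ← (h₁ φ ψ).2, ← (h₂ φ ψ).2,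
    add_apply, inner_add_right]

theorem IsOperatorOfWeight.const_smul {ϖ : ℂ → ℂ} {M : StateSpace →L[ℂ] StateSpace}
    (h : IsOperatorOfWeight ϖ M) (c : ℂ) : IsOperatorOfWeight (c • ϖ) (c • M) := by
  intro φ ψ
  simp only [Pi.smul_apply, smul_eq_mul, mul_assoc]
  refine ⟨(h φ ψ).1.const_mul c, ?_⟩
  rw [integral_const_mul, mul_left_comm, ← (h φ ψ).2, smul_apply,
    inner_smul_right]

/-- The function `m(s) = cos (3 s / 2)` of a quantization other than that of Weyl and Wigner. -/
def cosWeight (s : ℝ) : ℝ := Real.cos (3 / 2 * s)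

theorem cosWeight_zero : cosWeight 0 = 1 := by
  rw [cosWeight, mul_zero, Real.cos_zero]

theorem hasTemperateGrowth_cosWeight : cosWeight.HasTemperateGrowth := by
  convert Complex.reCLM.hasTemperateGrowth.comp
    (hasTemperateGrowth_cexp_ofReal_mul_I.comp (f := fun s : ℝ => 3 / 2 * s) (by fun_prop)) using 1
  funext s
  exact (Complex.exp_ofReal_mul_I_re _).symm

theorem hyperbolicWeight_cosWeight :
    hyperbolicWeight cosWeight = (1 / 2 : ℂ) • (expWeight (3 / 2) + expWeight (-(3 / 2))) := by
  funext z
  simp only [hyperbolicWeight, cosWeight, Complex.ofReal_cos, Complex.cos, expWeight,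
    Pi.smul_apply, Pi.add_apply, smul_eq_mul, neg_mul (3 / 2 : ℝ), Complex.ofReal_neg]
  ring

/-- The operator `ψ ↦ (ψ(2 x) + ψ(x / 2) / 2) / 2` of the weight `cos (3 Im z² / 2)`. -/
def dilationMean : StateSpace →L[ℂ] StateSpace :=
  (1 / 2 : ℂ) • (dilation two_ne_zero + (1 / 2 : ℂ) • dilation (inv_ne_zero two_ne_zero))

theorem isOperatorOfWeight_dilationMean :
    IsOperatorOfWeight (hyperbolicWeight cosWeight) dilationMean := by
  rw [hyperbolicWeight_cosWeight]
  refine ((isOperatorOfWeight_expWeight (by norm_num) fun ψ => ?_).add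
    (isOperatorOfWeight_expWeight (by norm_num) fun ψ => ?_)).const_smul _
  · filter_upwards [coeFn_dilation_vec two_ne_zero ψ] with x hx
    rw [hx]
    norm_num
  · filter_upwards [Lp.coeFn_smul (1 / 2 : ℂ) (dilation (inv_ne_zero two_ne_zero) (vec ψ)),
      coeFn_dilation_vec (inv_ne_zero two_ne_zero) ψ] with x hsmul hx
    refine (hsmul.trans (congrArg ((1 / 2 : ℂ) * ·) hx)).trans ?_
    norm_num

end Dilations

section Characters

variable {ϖ : ℂ → ℂ} {M : StateSpace →L[ℂ] StateSpace}

theorem integrable_formIntegrand_symplecticCharacter (hϖ : ϖ.HasTemperateGrowth)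
    (hM : IsOperatorOfWeight ϖ M) (z : ℂ) (φ ψ : 𝓢(ℝ, ℂ)) :
    Integrable (formIntegrand M (symplecticCharacter z) (vec φ) (vec ψ)) := by
  refine integrable_formIntegrand hϖ hM (C := 1) (k := 0) ?_ (fun w => ?_) φ ψ
  · unfold symplecticCharacter
    fun_prop
  · rw [symplecticCharacter, Complex.norm_exp_ofReal_mul_I, pow_zero, mul_one]

theorem symplecticCharacter_phasePoint (z ξ : ℂ) :
    symplecticCharacter z (phasePoint ξ) = Real.fourierChar ⟪ξ, z⟫_ℝ := by
  have h := symplecticCharacter_neg_phasePoint z (-ξ)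
  rwa [phasePoint, mul_neg, neg_neg, ← phasePoint, inner_neg_right, neg_neg,
    real_inner_comm] at h

theorem quantForm_symplecticCharacter (hϖ : ϖ.HasTemperateGrowth)
    (hM : IsOperatorOfWeight ϖ M) (z : ℂ) (φ ψ : 𝓢(ℝ, ℂ)) :
    quantForm M (symplecticCharacter z) (vec φ) (vec ψ)
      = ⟪vec φ, ϖ z • displacement z (vec ψ)⟫_ℂ := by
  obtain ⟨W, hW⟩ := exists_schwartz_eq_weight_mul_ambiguity hϖ φ ψ
  have hinv : 𝓕⁻ (𝓕 W) z = W z := by rw [FourierPair.fourierInv_fourier_eq]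
  rw [inner_smul_right, inner_displacement_vec, ← hW, ← hinv, fourierInv_coe, Real.fourierInv_eq,
    quantForm_vec_eq hM]
  simp only [symplecticCharacter_phasePoint, ← hW, ← fourier_coe, Circle.smul_def, smul_eq_mul]

theorem mem_graph_quantize_symplecticCharacter (hϖ : ϖ.HasTemperateGrowth)
    (hM : IsOperatorOfWeight ϖ M) (z : ℂ) (ψ : 𝓢(ℝ, ℂ)) :
    (vec ψ, ϖ z • displacement z (vec ψ)) ∈ (quantize M (symplecticCharacter z)).graph :=
  vec_mem_graph_quantize fun φ => ⟨integrable_formIntegrand_symplecticCharacter hϖ hM z φ ψ,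
    quantForm_symplecticCharacter hϖ hM z φ ψ⟩

theorem domain_quantize_symplecticCharacter (hϖ : ϖ.HasTemperateGrowth)
    (hM : IsOperatorOfWeight ϖ M) (z : ℂ) :
    (quantize M (symplecticCharacter z)).domain = schwartzDomain :=
  domain_quantize_eq fun ψ => ⟨_, mem_graph_quantize_symplecticCharacter hϖ hM z ψ⟩

theorem exists_vec_ne_zero : ∃ χ : 𝓢(ℝ, ℂ), vec χ ≠ 0 := by
  obtain ⟨χ, hχ⟩ := exists_schwartz_eq_one 1
  refine ⟨χ, fun h => ?_⟩
  have hae : (χ : ℝ → ℂ) =ᵐ[volume] fun _ => 0 := by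
    have hvec := coeFn_vec χ
    rw [h] at hvec
    exact hvec.symm.trans (Lp.coeFn_zero ℂ 2 volume)
  have hzero := (Continuous.ae_eq_iff_eq volume χ.continuous continuous_const).1 hae
  have hone := hχ 0 (by simp)
  rw [hzero] at hone
  exact zero_ne_one hone

theorem quantize_ne_of_weight_ne {ϖ₁ ϖ₂ : ℂ → ℂ} {M₁ M₂ : StateSpace →L[ℂ] StateSpace}
    (h₁ : ϖ₁.HasTemperateGrowth) (hM₁ : IsOperatorOfWeight ϖ₁ M₁)
    (h₂ : ϖ₂.HasTemperateGrowth) (hM₂ : IsOperatorOfWeight ϖ₂ M₂) {z : ℂ} (hz : ϖ₁ z ≠ ϖ₂ z) :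
    quantize M₁ (symplecticCharacter z) ≠ quantize M₂ (symplecticCharacter z) := by
  intro h
  obtain ⟨χ, hχ⟩ := exists_vec_ne_zero
  have hgraph₁ := mem_graph_quantize_symplecticCharacter h₁ hM₁ z χ
  rw [h] at hgraph₁
  have hsmul : ϖ₁ z • displacement z (vec χ) = ϖ₂ z • displacement z (vec χ) :=
    LinearPMap.mem_graph_snd_inj _ hgraph₁
      (mem_graph_quantize_symplecticCharacter h₂ hM₂ z χ) rfl
  refine hz (smul_left_injective ℂ (fun h₀ => hχ ?_) hsmul)
  rw [← norm_eq_zero, ← (displacement z).norm_map, h₀, norm_zero]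

theorem exists_hyperbolicWeight_cosWeight_ne :
    ∃ z, hyperbolicWeight cosWeight z ≠ hyperbolicWeight (fun _ => 1) z := by
  refine ⟨⟨π, 1 / 3⟩, ?_⟩
  rw [hyperbolicWeight, hyperbolicWeight, im_sq_mk, cosWeight,
    show 3 / 2 * (2 * π * (1 / 3)) = π by ring, Real.cos_pi]
  norm_num

end Characters

end WeylHeisenberg

end

open WeylHeisenberg in
theorem mainTheorem7 :
    (∀ (m : ℝ → ℝ) (M : StateSpace →L[ℂ] StateSpace),
      Measurable m → ContinuousAt m 0 → m 0 = 1 →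
      IsOperatorOfWeight (hyperbolicWeight m) M →
      (∀ f : ℝ → ℂ, Measurable f →
        -- equality of the sesquilinear forms, wherever the form of `A_f` is defined
        (∀ φ ψ : 𝓢(ℝ, ℂ),
          Integrable (formIntegrand M (fun z => f (position z)) (vec φ) (vec ψ)) →
          Integrable (fun x : ℝ => star (φ x) * f x * ψ x) ∧
          quantForm M (fun z => f (position z)) (vec φ) (vec ψ)
            = ∫ x : ℝ, star (φ x) * f x * ψ x) ∧
        (∀ φ ψ : 𝓢(ℝ, ℂ),
          Integrable (formIntegrand M (fun z => f (momentum z)) (vec φ) (vec ψ)) →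
          Integrable (fun ξ : ℝ => star (𝓕 φ ξ) * f (2 * Real.pi * ξ) * 𝓕 ψ ξ) ∧
          quantForm M (fun z => f (momentum z)) (vec φ) (vec ψ)
            = ∫ ξ : ℝ, star (𝓕 φ ξ) * f (2 * Real.pi * ξ) * 𝓕 ψ ξ) ∧
        -- equality of the operators
        (quantize M fun z => f (position z)) ≤ functionOfQ f ∧
        (quantize M fun z => f (momentum z)) ≤ functionOfP f ∧
        ((quantize M fun z => f (position z)).domain = schwartzDomain →
          (quantize M fun z => f (position z)).closure = functionOfQ f) ∧
        ((quantize M fun z => f (momentum z)).domain = schwartzDomain →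
          (quantize M fun z => f (momentum z)).closure = functionOfP f)) ∧
      -- the same, with no convergence assumption, for Gaussian summable integrals
      (∀ f : ℝ → ℂ, IsFourierStieltjes f → ∀ φ ψ : 𝓢(ℝ, ℂ),
        QuantFormTendsto M (fun z => f (position z)) (vec φ) (vec ψ)
          (∫ x : ℝ, star (φ x) * f x * ψ x) ∧
        QuantFormTendsto M (fun z => f (momentum z)) (vec φ) (vec ψ)
          (∫ ξ : ℝ, star (𝓕 φ ξ) * f (2 * Real.pi * ξ) * 𝓕 ψ ξ)) ∧
      -- no convergence assumption is needed for smooth `m` of temperate growth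
      (m.HasTemperateGrowth → IsCanonicalOnQAndP M)) ∧
    -- Weyl–Wigner quantization is the case `m = 1` and has the property
    (IsOperatorOfWeight (hyperbolicWeight fun _ => 1) weylWigner ∧
      IsCanonicalOnQAndP weylWigner) ∧
    -- it is not the only one
    (∃ (m : ℝ → ℝ) (M : StateSpace →L[ℂ] StateSpace),
      m.HasTemperateGrowth ∧ m 0 = 1 ∧ IsOperatorOfWeight (hyperbolicWeight m) M ∧
      IsCanonicalOnQAndP M ∧
      ∃ F : ℂ → ℂ, (quantize M F).domain = schwartzDomain ∧
        (quantize weylWigner F).domain = schwartzDomain ∧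
        quantize M F ≠ quantize weylWigner F) := by
  refine ⟨fun m M hm hc h0 hM => ⟨fun f _ => ?_, fun f hf φ ψ => ?_, fun ht => ?_⟩, ?_, ?_⟩
  · have hQ := quantize_position_le_functionOfQ hm hc h0 hM f
    have hP := quantize_momentum_le_functionOfP hm hc h0 hM f
    exact ⟨integrable_and_quantForm_position_eq hm hc h0 hM f,
      integrable_and_quantForm_momentum_eq hm hc h0 hM f, hQ, hP,
      closure_eq_functionOfQ hQ, closure_eq_functionOfP hP⟩
  · exact ⟨quantFormTendsto_position hc h0 hM hf φ ψ, quantFormTendsto_momentum hc h0 hM hf φ ψ⟩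
  · exact isCanonicalOnQAndP ht h0 hM
  · exact ⟨isOperatorOfWeight_weylWigner,
      isCanonicalOnQAndP (.const 1) rfl isOperatorOfWeight_weylWigner⟩
  · have hcos := hasTemperateGrowth_hyperbolicWeight hasTemperateGrowth_cosWeight
    have hone := hasTemperateGrowth_hyperbolicWeight (.const 1)
    obtain ⟨z, hz⟩ := exists_hyperbolicWeight_cosWeight_ne
    exact ⟨cosWeight, dilationMean, hasTemperateGrowth_cosWeight, cosWeight_zero,
      isOperatorOfWeight_dilationMean,
      isCanonicalOnQAndP hasTemperateGrowth_cosWeight cosWeight_zero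
        isOperatorOfWeight_dilationMean,
      symplecticCharacter z, domain_quantize_symplecticCharacter hcos
        isOperatorOfWeight_dilationMean z,
      domain_quantize_symplecticCharacter hone isOperatorOfWeight_weylWigner z,
      quantize_ne_of_weight_ne hcos isOperatorOfWeight_dilationMean hone
        isOperatorOfWeight_weylWigner hz⟩
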